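/- Let $K$ be a non-Archimedean local field with residue field of cardinality $q=p^c$ ($p$ prime, $c\ge 1$), ring of integers $\mathcal D=\{|x|\le 1\}$, prime ideal $\mathcal P=\{|x|<1\}$, prime element $\mathfrak p$, absolute value normalized by $|\mathfrak p|=q^{-1}$, and Haar measure $dx$ with $\int_{\mathcal D}dx=1$. Let $\chi$ be a continuous unitary character of $(K,+)$ that is trivial on $\mathcal D$ and non-trivial on $\mathcal P^{-1}$; put $\hat f(\xi)=\int_K f(x)\overline{\chi(\xi x)}\,dx$ for locally constant, compactly supported $f$ and $\langle \hat T,f\rangle=\langle T,\hat f\rangle$ for tempered distributions $T$. Fix $e_0=1,e_1,\dots,e_{c-1}\in\mathcal D$ whose residues form a basis of the residue field over $\mathbb F_p$. For $n=u_0+u_1p+\dots+u_{c-1}p^{c-1}<q$ ($0\le u_i<p$) put $\lambda(n)=(u_0e_0+\dots+u_{c-1}e_{c-1})\mathfrak p^{-1}$, and for $n=v_0+v_1q+\dots+v_rq^r$ ($0\le v_i<q$) put $\lambda(n)=\lambda(v_0)+\mathfrak p^{-1}\lambda(v_1)+\dots+\mathfrak p^{-r}\lambda(v_r)$. For $\mathfrak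 s\in\mathbb R$ let $H^{\mathfrak s}(K)$ be the Hilbert space of tempered distributions $T$ whose Fourier transform is a locally integrable function with $\|T\|^2_{H^{\mathfrak s}}=\int_K(1+|\xi|^2)^{\mathfrak s}|\hat T(\xi)|^2\,d\xi<\infty$, with the corresponding inner product. For every $j\in\mathbb Z$ let $\varphi^{(j)}\in H^{\mathfrak s}(K)$ be such that the distributions $\varphi_{j,k}=q^{j/2}\varphi^{(j)}(\mathfrak p^{-j}\cdot-\lambda(k))$, $k=0,1,2,\dots$, are orthonormal in $H^{\mathfrak s}(K)$. Let $\mathsf V_j$ be the closed linear span of $\{\varphi_{j,k}:k\ge 0\}$ in $H^{\mathfrak s}(K)$ and let $P_j$ be the orthogonal projection of $H^{\mathfrak s}(K)$ onto $\mathsf V_j$. Then for each $h\in H^{\mathfrak s}(K)$ the integrals below are finite for all $j\in\mathbb Z$, and $$\lim_{j\to+\infty}\Bigl(\|P_jh\|^2_{H^{\mathfrak s}}-\int_K(1+|\xi|^2)^{2\mathfrak s}\,|\hat h(\xi)|^2\,|\hat\varphi^{(j)}(\mathfrak p^j\xi)|^2\,d\xi\Bigr)=0.$$ If moreover there are $A\in\mathbb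 R$ and $\theta>0$ such that $\int_K(1+|\xi|^2)^{\theta}|\hat\varphi^{(j)}(\xi)|^2\,d\xi\le A$ for every $j\le 0$, then $\bigcap_{j\in\mathbb Z}\mathsf V_j=\{0\}$. -/

import Mathlib

open MeasureTheory Filter Topology
open scoped NNReal ENNReal NormedField Valued ComplexConjugate Pointwise

noncomputable section

namespace LocalFieldMRA

section Basic

variable (K : Type*) [NontriviallyNormedField K] [ProperSpace K] [MeasurableSpace K] [BorelSpace K]

/-- The closed unit ball (the ring of integers as a subset), a compact set with non-empty
interior. -/
def unitBall : TopologicalSpace.PositiveCompacts K where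
  carrier := Metric.closedBall 0 1
  isCompact' := isCompact_closedBall 0 1
  interior_nonempty' :=
    ⟨0, Metric.ball_subset_interior_closedBall (Metric.mem_ball_self one_pos)⟩

/-- The Haar measure of the additive group of `K` that gives the ring of integers mass `1`. -/
def haar : Measure K := Measure.addHaarMeasure (unitBall K)

instance : (haar K).IsAddHaarMeasure := by unfold haar; infer_instance

instance : (haar K).Regular := by unfold haar; infer_instance

end Basic

/-- A prime element: an element of maximal absolute value in the prime ideal. -/
structure IsPrimeElement {K : Type*} [NontriviallyNormedField K] (ϖ : K) : Prop where
  ne_zero : ϖ ≠ 0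
  norm_lt_one : ‖ϖ‖ < 1
  norm_le : ∀ x : K, ‖x‖ < 1 → ‖x‖ ≤ ‖ϖ‖

/-- A continuous unitary character of the additive group of `K` which is trivial on the ring of
integers `𝓓 = {|x| ≤ 1}` and non-trivial on `𝓟⁻¹ = {x | x 𝓟 ⊆ 𝓓}`, where `𝓟 = {|y| < 1}`. -/
structure StandardCharacter (K : Type*) [NontriviallyNormedField K] where
  toAddChar : AddChar K Circle
  continuous_toAddChar : Continuous toAddChar
  eq_one_of_norm_le_one : ∀ x : K, ‖x‖ ≤ 1 → toAddChar x = 1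
  exists_ne_one : ∃ x : K, (∀ y : K, ‖y‖ < 1 → ‖x * y‖ ≤ 1) ∧ toAddChar x ≠ 1

section Translations

variable {K : Type*} [NontriviallyNormedField K] [IsUltrametricDist K] {p c : ℕ}

/-- For `n = u₀ + u₁ p + ⋯ + u_{c-1} p^{c-1} < p ^ c`, the element
`(u₀ e₀ + u₁ e₁ + ⋯ + u_{c-1} e_{c-1}) ϖ⁻¹`. -/
def translationDigit (p : ℕ) (ϖ : K) (e : Fin c → 𝒪[K]) (n : ℕ) : K :=
  (∑ i : Fin c, ((n / p ^ (i : ℕ) % p : ℕ) : K) * (e i : K)) * ϖ⁻¹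

/-- For `n = v₀ + v₁ q + ⋯ + v_s q^s` with `0 ≤ v_k < q = p ^ c`, the element
`λ(n) = λ(v₀) + ϖ⁻¹ λ(v₁) + ⋯ + ϖ⁻ˢ λ(v_s)`. The sum may run over all `k ≤ n`, since the digits
`v_k` with `k > s` vanish and `λ(0) = 0`. -/
def translation (p : ℕ) (ϖ : K) (e : Fin c → 𝒪[K]) (n : ℕ) : K :=
  ∑ k ∈ Finset.range (n + 1),
    (ϖ⁻¹) ^ k * translationDigit p ϖ e (n / (p ^ c) ^ k % p ^ c)

end Translations

section TestFunctions

variable (K : Type*) [NontriviallyNormedField K]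

/-- The Schwartz(–Bruhat) space `𝓢(K)`: locally constant functions with compact support. -/
def TestFunction : Submodule ℂ (K → ℂ) where
  carrier := {f | IsLocallyConstant f ∧ HasCompactSupport f}
  add_mem' := fun hf hg => ⟨hf.1.add hg.1, hf.2.add hg.2⟩
  zero_mem' := ⟨IsLocallyConstant.const 0, HasCompactSupport.zero⟩
  smul_mem' := fun a _ hf =>
    ⟨hf.1.comp (fun z => a • z), hf.2.comp_left (g := fun z => a • z) (smul_zero a)⟩

/-- Tempered distributions. The space `𝓢(K)` carries the inductive limit topology of its
finite-dimensional subspaces (functions with support in `{|x| ≤ R}` which are constant on the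
cosets of `{|x| ≤ r}`), so that every linear functional on `𝓢(K)` is continuous. -/
abbrev TemperedDistribution := TestFunction K →ₗ[ℂ] ℂ

variable {K}

lemma integrable_testFunction [MeasurableSpace K] [BorelSpace K] (μ : Measure K)
    [IsFiniteMeasureOnCompacts μ] (f : TestFunction K) : Integrable (f : K → ℂ) μ :=
  f.2.1.continuous.integrable_of_hasCompactSupport f.2.2

/-- The test function `x ↦ f (a⁻¹ (x + b))`. -/
def TestFunction.affine (a b : K) (ha : a ≠ 0) : TestFunction K →ₗ[ℂ] TestFunction K where
  toFun f := ⟨fun x => (f : K → ℂ) (a⁻¹ * (x + b)),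
    f.2.1.comp_continuous (by fun_prop),
    f.2.2.comp_homeomorph ((Homeomorph.addRight b).trans (Homeomorph.mulLeft₀ a⁻¹ (inv_ne_zero ha)))⟩
  map_add' _ _ := rfl
  map_smul' _ _ := rfl

/-- The distribution `T (a · - b)` for `a ≠ 0`, defined by
`⟨T (a · - b), f⟩ = |a|⁻¹ ⟨T, f (a⁻¹ (· + b))⟩`, where `|·|` is the normalized absolute value. -/
def TemperedDistribution.affine (a b : K) (ha : a ≠ 0) (T : TemperedDistribution K) :
    TemperedDistribution K :=
  ((‖a‖⁻¹ : ℝ) : ℂ) • (T ∘ₗ TestFunction.affine a b ha)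

variable [IsUltrametricDist K] [ProperSpace K]

lemma exists_params (f : TestFunction K) :
    ∃ a b : K, a ≠ 0 ∧ b ≠ 0 ∧ (∀ x y, ‖y‖ ≤ ‖a‖ → (f : K → ℂ) (x + y) = (f : K → ℂ) x) ∧
      ∀ x, ‖b‖ < ‖x‖ → (f : K → ℂ) x = 0 := by
  obtain ⟨R, hR⟩ := f.2.2.isCompact.isBounded.subset_closedBall (0 : K)
  obtain ⟨b, hb⟩ := NormedField.exists_lt_norm K (max R 1)
  have hb0 : b ≠ 0 := by
    rintro rfl
    have := (le_max_right R 1).trans_lt hb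
    norm_num at this
  have hsupp : ∀ x, ‖b‖ < ‖x‖ → (f : K → ℂ) x = 0 := by
    intro x hx
    by_contra h
    have := hR (subset_tsupport _ h)
    rw [mem_closedBall_zero_iff] at this
    linarith [le_max_left R 1]
  obtain ⟨δ, hδ, h⟩ := lebesgue_number_lemma_of_metric
    (c := fun z : ℂ => (f : K → ℂ) ⁻¹' {z}) (isCompact_closedBall (0 : K) ‖b‖)
    (fun z => f.2.1.isOpen_fiber z) (fun x _ => Set.mem_iUnion.2 ⟨_, rfl⟩)
  have hδb : 0 < min δ ‖b‖ := lt_min hδ (norm_pos_iff.2 hb0)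
  obtain ⟨a, ha0, ha⟩ := NormedField.exists_norm_lt K hδb
  refine ⟨a, b, norm_pos_iff.1 ha0, hb0, fun x y hy => ?_, hsupp⟩
  have hyδ : ‖y‖ < δ := hy.trans_lt (ha.trans_le (min_le_left _ _))
  have hyb : ‖y‖ < ‖b‖ := hy.trans_lt (ha.trans_le (min_le_right _ _))
  by_cases hx : ‖x‖ ≤ ‖b‖
  · obtain ⟨z, hz⟩ := h x (mem_closedBall_zero_iff.2 hx)
    have h1 : (f : K → ℂ) (x + y) = z := hz (by simpa [Metric.mem_ball, dist_eq_norm] using hyδ)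
    have h2 : (f : K → ℂ) x = z := hz (Metric.mem_ball_self hδ)
    rw [h1, h2]
  · push Not at hx
    have hxy : ‖b‖ < ‖x + y‖ := by
      rw [IsUltrametricDist.norm_add_eq_max_of_norm_ne_norm (by linarith [hyb.trans hx])]
      exact hx.trans_le (le_max_left _ _)
    rw [hsupp _ hx, hsupp _ hxy]

lemma mem_testFunction_of_params {f : K → ℂ} {a b : K} (ha : a ≠ 0)
    (h1 : ∀ x y, ‖y‖ ≤ ‖a‖ → f (x + y) = f x) (h2 : ∀ x, ‖b‖ < ‖x‖ → f x = 0) :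
    f ∈ TestFunction K := by
  refine ⟨?_, ?_⟩
  · rw [IsLocallyConstant.iff_exists_open]
    intro x
    refine ⟨Metric.ball x ‖a‖, Metric.isOpen_ball, Metric.mem_ball_self (norm_pos_iff.2 ha), ?_⟩
    intro y hy
    rw [Metric.mem_ball, dist_eq_norm] at hy
    simpa using h1 x (y - x) hy.le
  · refine HasCompactSupport.intro (isCompact_closedBall (0 : K) ‖b‖) fun x hx => h2 x ?_
    simpa using hx

end TestFunctions

namespace StandardCharacter

variable {K : Type*} [NontriviallyNormedField K]

lemma norm_le_one_of_forall (χ : StandardCharacter K) {x : K}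
    (h : ∀ y : K, ‖y‖ ≤ 1 → χ.toAddChar (x * y) = 1) : ‖x‖ ≤ 1 := by
  by_contra! hx
  obtain ⟨z, hz, hz1⟩ := χ.exists_ne_one
  have hx0 : x ≠ 0 := norm_pos_iff.1 (by linarith)
  have hz0 : z ≠ 0 := by rintro rfl; simp at hz1
  refine hz1 ?_
  rw [show z = x * (x⁻¹ * z) by field_simp]
  apply h
  by_contra! hlt
  rw [norm_mul, norm_inv] at hlt
  have hxz : ‖x * z⁻¹‖ < 1 := by
    have := norm_pos_iff.2 hz0
    have := norm_pos_iff.2 hx0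
    rw [norm_mul, norm_inv]
    field_simp at hlt ⊢
    linarith
  have := hz _ hxz
  rw [show z * (x * z⁻¹) = x by field_simp] at this
  linarith

variable [MeasurableSpace K] [BorelSpace K] [ProperSpace K]

/-- The Fourier integral `f̂(ξ) = ∫ f(x) χ(-ξ x) dx`. -/
def fourierIntegral (χ : StandardCharacter K) (f : K → ℂ) (ξ : K) : ℂ :=
  ∫ x, f x * (χ.toAddChar (-(ξ * x)) : ℂ) ∂haar K

lemma fourierIntegral_eq (χ : StandardCharacter K) (f : K → ℂ) :
    χ.fourierIntegral f =
      VectorFourier.fourierIntegral χ.toAddChar (haar K) (LinearMap.mul K K) f := by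
  ext ξ
  simp only [fourierIntegral, VectorFourier.fourierIntegral, LinearMap.mul_apply', Circle.smul_def,
    smul_eq_mul]
  congr 1
  ext x
  rw [mul_comm, mul_comm ξ]

lemma fourierIntegral_eq_zero (χ : StandardCharacter K) {f : K → ℂ} {a ξ : K}
    (h1 : ∀ x y, ‖y‖ ≤ ‖a‖ → f (x + y) = f x) (ha : a ≠ 0) (hξ : ‖a⁻¹‖ < ‖ξ‖) :
    χ.fourierIntegral f ξ = 0 := by
  by_contra hne
  have key : ∀ y : K, ‖y‖ ≤ ‖a‖ → χ.toAddChar (ξ * y) = 1 := by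
    intro y hy
    have e1 : χ.fourierIntegral f ξ = χ.fourierIntegral f ξ * (χ.toAddChar (-(ξ * y)) : ℂ) := by
      conv_lhs => unfold fourierIntegral
      rw [← integral_add_right_eq_self _ y]
      unfold fourierIntegral
      rw [← integral_mul_const]
      congr 1
      ext x
      rw [h1 x y hy, mul_add, neg_add, AddChar.map_add_eq_mul]
      push_cast
      ring
    have e2 : (χ.toAddChar (-(ξ * y)) : ℂ) = 1 :=
      (mul_left_cancel₀ hne ((mul_one _).trans e1)).symm
    have e3 : χ.toAddChar (-(ξ * y)) = 1 := by
      apply Circle.ext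
      simpa using e2
    rw [AddChar.map_neg_eq_inv] at e3
    simpa using e3
  have : ‖ξ * a‖ ≤ 1 := by
    apply χ.norm_le_one_of_forall
    intro y hy
    rw [mul_assoc]
    apply key
    rw [norm_mul]
    exact mul_le_of_le_one_right (norm_nonneg _) hy
  have ha' := norm_pos_iff.2 ha
  rw [norm_mul] at this
  rw [norm_inv, inv_lt_iff_one_lt_mul₀ ha'] at hξ
  linarith [mul_comm ‖ξ‖ ‖a‖]

variable [IsUltrametricDist K]

lemma fourierIntegral_mem (χ : StandardCharacter K) (f : TestFunction K) :
    χ.fourierIntegral f ∈ TestFunction K := by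
  obtain ⟨a, b, ha, hb, h1, h2⟩ := exists_params f
  refine mem_testFunction_of_params (a := b⁻¹) (b := a⁻¹) (inv_ne_zero hb) ?_ ?_
  · intro ξ η hη
    unfold fourierIntegral
    congr 1
    ext x
    by_cases hx : ‖b‖ < ‖x‖
    · simp [h2 x hx]
    · have : ‖-(η * x)‖ ≤ 1 := by
        rw [norm_neg, norm_mul]
        calc ‖η‖ * ‖x‖ ≤ ‖b⁻¹‖ * ‖b‖ := by
              gcongr
              exact not_lt.1 hx
          _ = 1 := by rw [← norm_mul, inv_mul_cancel₀ hb, norm_one]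
      rw [add_mul, neg_add, AddChar.map_add_eq_mul, χ.eq_one_of_norm_le_one _ this, mul_one]
  · exact fun ξ hξ => χ.fourierIntegral_eq_zero h1 ha hξ

/-- The Fourier transform on the Schwartz space. -/
def fourier (χ : StandardCharacter K) : TestFunction K →ₗ[ℂ] TestFunction K where
  toFun f := ⟨χ.fourierIntegral f, χ.fourierIntegral_mem f⟩
  map_add' f g := by
    apply Subtype.ext
    have hL : Continuous fun p : K × K => (LinearMap.mul K K) p.1 p.2 := by
      simp only [LinearMap.mul_apply']; fun_prop
    change χ.fourierIntegral (f + g : K → ℂ) = χ.fourierIntegral f + χ.fourierIntegral g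
    simp only [fourierIntegral_eq]
    exact VectorFourier.fourierIntegral_add χ.continuous_toAddChar hL
      (integrable_testFunction _ f) (integrable_testFunction _ g)
  map_smul' r f := by
    apply Subtype.ext
    change χ.fourierIntegral (r • f : K → ℂ) = r • χ.fourierIntegral f
    simp only [fourierIntegral_eq]
    exact VectorFourier.fourierIntegral_const_smul _ _ _ _ _

lemma haar_closedBall_mul {a : K} (ha : a ≠ 0) :
    (haar K).real (Metric.closedBall 0 ‖a‖) * (haar K).real (Metric.closedBall 0 ‖a⁻¹‖) = 1 := by
  have key : ∀ u : Kˣ, (haar K).real (Metric.closedBall 0 ‖(u : K)‖) =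
      (distribHaarChar K u : ℝ) := by
    intro u
    have h1 : haar K (Metric.closedBall 0 1) = 1 := Measure.addHaarMeasure_self
    have h2 : u • (Metric.closedBall (0 : K) 1) = Metric.closedBall 0 ‖(u : K)‖ := by
      ext x
      have hu : 0 < ‖(u : K)‖ := norm_pos_iff.2 u.ne_zero
      rw [Set.mem_smul_set_iff_inv_smul_mem, mem_closedBall_zero_iff, mem_closedBall_zero_iff,
        Units.smul_def, smul_eq_mul, norm_mul, Units.val_inv_eq_inv_val, norm_inv,
        inv_mul_le_iff₀ hu, mul_one]
    rw [measureReal_def, ← h2, ← distribHaarChar_mul (haar K) u, h1]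
    simp
  have e1 := key (Units.mk0 a ha)
  have e2 := key (Units.mk0 a ha)⁻¹
  rw [Units.val_inv_eq_inv_val] at e2
  rw [Units.val_mk0] at e1 e2
  rw [e1, e2, map_inv]
  have := (distribHaarChar_pos (A := K) (g := Units.mk0 a ha)).ne'
  push_cast
  exact mul_inv_cancel₀ (by exact_mod_cast this)

lemma integral_char_closedBall (χ : StandardCharacter K) {d : K} (z : K) :
    ∫ x in Metric.closedBall 0 ‖d‖, (χ.toAddChar (-(z * x)) : ℂ) ∂haar K =
      if ‖z * d‖ ≤ 1 then ((haar K).real (Metric.closedBall 0 ‖d‖) : ℂ) else 0 := by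
  split_ifs with h
  · rw [setIntegral_congr_fun (g := fun _ => (1 : ℂ)) Metric.isClosed_closedBall.measurableSet]
    · simp
    · intro x hx
      rw [mem_closedBall_zero_iff] at hx
      have : ‖-(z * x)‖ ≤ 1 := by
        rw [norm_neg, norm_mul]
        rw [norm_mul] at h
        exact (mul_le_mul_of_nonneg_left hx (norm_nonneg _)).trans h
      simp [χ.eq_one_of_norm_le_one _ this]
  · have : ∃ y : K, ‖y‖ ≤ 1 ∧ χ.toAddChar (z * d * y) ≠ 1 := by
      by_contra! hc
      exact h (χ.norm_le_one_of_forall hc)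
    obtain ⟨y, hy, hy1⟩ := this
    set I := ∫ x in Metric.closedBall 0 ‖d‖, (χ.toAddChar (-(z * x)) : ℂ) ∂haar K with hI
    have e1 : I = I * (χ.toAddChar (-(z * d * y)) : ℂ) := by
      conv_lhs => rw [hI]
      rw [← integral_indicator Metric.isClosed_closedBall.measurableSet,
        ← integral_add_right_eq_self _ (d * y), hI, ← integral_mul_const,
        ← integral_indicator Metric.isClosed_closedBall.measurableSet]
      congr 1
      ext x
      have hdy : ‖d * y‖ ≤ ‖d‖ := by
        rw [norm_mul]
        exact mul_le_of_le_one_right (norm_nonneg _) hy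
      have hiff : x + d * y ∈ Metric.closedBall (0 : K) ‖d‖ ↔ x ∈ Metric.closedBall (0 : K) ‖d‖ := by
        rw [mem_closedBall_zero_iff, mem_closedBall_zero_iff]
        constructor
        · intro hx
          have := IsUltrametricDist.norm_add_le_max (x + d * y) (-(d * y))
          rw [add_neg_cancel_right, norm_neg] at this
          exact this.trans (max_le hx hdy)
        · intro hx
          exact (IsUltrametricDist.norm_add_le_max _ _).trans (max_le hx hdy)
      by_cases hx : x ∈ Metric.closedBall (0 : K) ‖d‖
      · rw [Set.indicator_of_mem (hiff.2 hx), Set.indicator_of_mem hx, mul_add, neg_add,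
          AddChar.map_add_eq_mul, ← mul_assoc]
        push_cast
        rfl
      · rw [Set.indicator_of_notMem (fun h => hx (hiff.1 h)), Set.indicator_of_notMem hx]
    by_contra hne
    have e2 : (χ.toAddChar (-(z * d * y)) : ℂ) = 1 :=
      (mul_left_cancel₀ hne ((mul_one _).trans e1)).symm
    have e3 : χ.toAddChar (-(z * d * y)) = 1 := by
      apply Circle.ext
      simpa using e2
    rw [AddChar.map_neg_eq_inv] at e3
    exact hy1 (by simpa using e3)

/-- Fourier inversion on the Schwartz space. -/
lemma fourier_fourier (χ : StandardCharacter K) (f : TestFunction K) (x : K) :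
    (χ.fourier (χ.fourier f) : K → ℂ) x = (f : K → ℂ) (-x) := by
  classical
  obtain ⟨a, b, ha, hb, h1, h2⟩ := exists_params f
  have hL : Continuous fun p : K × K => (LinearMap.mul K K) p.1 p.2 := by
    simp only [LinearMap.mul_apply']; fun_prop
  have hmeas : MeasurableSet (Metric.closedBall (0 : K) ‖a⁻¹‖) :=
    Metric.isClosed_closedBall.measurableSet
  set g : K → ℂ := (Metric.closedBall (0 : K) ‖a⁻¹‖).indicator
    fun ξ => (χ.toAddChar (-(x * ξ)) : ℂ) with hg
  have hcont : ∀ z : K, Continuous fun ξ : K => (χ.toAddChar (-(z * ξ)) : ℂ) := fun z =>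
    continuous_subtype_val.comp (χ.continuous_toAddChar.comp (by fun_prop))
  have hgi : Integrable g (haar K) := by
    rw [hg, integrable_indicator_iff hmeas]
    exact ((hcont x).locallyIntegrable).integrableOn_isCompact (isCompact_closedBall _ _)
  have hflip := VectorFourier.integral_fourierIntegral_smul_eq_flip (μ := haar K) (ν := haar K)
    (L := LinearMap.mul K K) χ.continuous_toAddChar hL (integrable_testFunction (haar K) f) hgi
  have hLf : (LinearMap.mul K K).flip = LinearMap.mul K K := by
    ext; simp
  rw [hLf, ← fourierIntegral_eq, ← fourierIntegral_eq] at hflip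
  have hl : (χ.fourier (χ.fourier f) : K → ℂ) x = ∫ ξ, χ.fourierIntegral f ξ • g ξ ∂haar K := by
    change ∫ ξ, χ.fourierIntegral f ξ * _ ∂haar K = _
    congr 1
    ext ξ
    by_cases hξ : ξ ∈ Metric.closedBall (0 : K) ‖a⁻¹‖
    · rw [hg, Set.indicator_of_mem hξ, smul_eq_mul]
    · rw [hg, Set.indicator_of_notMem hξ, smul_zero, χ.fourierIntegral_eq_zero h1 ha, zero_mul]
      simpa using hξ
  have hgf : ∀ y, χ.fourierIntegral g y = (Metric.closedBall (-x) ‖a‖).indicator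
      (fun _ => ((haar K).real (Metric.closedBall 0 ‖a⁻¹‖) : ℂ)) y := by
    intro y
    have ha' := norm_pos_iff.2 ha
    have e : χ.fourierIntegral g y =
        ∫ ξ in Metric.closedBall 0 ‖a⁻¹‖, (χ.toAddChar (-((x + y) * ξ)) : ℂ) ∂haar K := by
      rw [← integral_indicator hmeas]
      unfold fourierIntegral
      congr 1
      ext ξ
      by_cases hξ : ξ ∈ Metric.closedBall (0 : K) ‖a⁻¹‖
      · rw [hg, Set.indicator_of_mem hξ, Set.indicator_of_mem hξ, add_mul, neg_add,
          AddChar.map_add_eq_mul]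
        push_cast
        rfl
      · rw [hg, Set.indicator_of_notMem hξ, Set.indicator_of_notMem hξ, zero_mul]
    rw [e, integral_char_closedBall, Set.indicator_apply]
    have : ‖(x + y) * a⁻¹‖ ≤ 1 ↔ y ∈ Metric.closedBall (-x) ‖a‖ := by
      rw [norm_mul, norm_inv, ← div_eq_mul_inv, div_le_one ha', Metric.mem_closedBall,
        dist_eq_norm, sub_neg_eq_add, add_comm]
    simp only [this]
  rw [hl, hflip]
  have hm2 : MeasurableSet (Metric.closedBall (-x) ‖a‖) := Metric.isClosed_closedBall.measurableSet
  have : (fun y => (f : K → ℂ) y • χ.fourierIntegral g y) = (Metric.closedBall (-x) ‖a‖).indicator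
      fun _ => (f : K → ℂ) (-x) * ((haar K).real (Metric.closedBall 0 ‖a⁻¹‖) : ℂ) := by
    ext y
    rw [hgf]
    by_cases hy : y ∈ Metric.closedBall (-x) ‖a‖
    · rw [Set.indicator_of_mem hy, Set.indicator_of_mem hy, smul_eq_mul]
      have := h1 (-x) (y - -x) (by simpa [dist_eq_norm] using hy)
      rw [add_sub_cancel] at this
      rw [this]
    · rw [Set.indicator_of_notMem hy, Set.indicator_of_notMem hy, smul_zero]
  rw [this, integral_indicator hm2, setIntegral_const]
  have hb1 : (haar K).real (Metric.closedBall (-x) ‖a‖) =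
      (haar K).real (Metric.closedBall 0 ‖a‖) := by
    rw [measureReal_def, measureReal_def, Measure.addHaar_closedBall_center]
  rw [hb1, Complex.real_smul]
  have := congrArg (fun r : ℝ => (r : ℂ)) (haar_closedBall_mul ha)
  push_cast at this
  linear_combination (f : K → ℂ) (-x) * this

end StandardCharacter

section Uniqueness

variable {K : Type*} [NontriviallyNormedField K] [IsUltrametricDist K] [ProperSpace K]
  [MeasurableSpace K] [BorelSpace K]

lemma integrable_mul_testFunction {u : K → ℂ} (hu : LocallyIntegrable u (haar K))
    (f : TestFunction K) : Integrable (fun x => u x * (f : K → ℂ) x) (haar K) := by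
  have := hu.integrable_smul_left_of_hasCompactSupport f.2.1.continuous f.2.2
  simpa [smul_eq_mul, mul_comm] using this

/-- Regular distributions determine the function almost everywhere. -/
lemma ae_eq_zero_of_forall_testFunction {u : K → ℂ} (hu : LocallyIntegrable u (haar K))
    (h : ∀ f : TestFunction K, ∫ x, u x * (f : K → ℂ) x ∂haar K = 0) : u =ᵐ[haar K] 0 := by
  apply ae_eq_zero_of_forall_setIntegral_isCompact_eq_zero' hu
  intro C hC
  obtain ⟨v, hv_anti, hv_pos, hv_lim⟩ := exists_seq_strictAnti_tendsto (0 : ℝ)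
  have hlim := tendsto_setIntegral_of_antitone (μ := haar K) (f := u)
    (s := fun n => Metric.thickening (v n) C)
    (fun n => Metric.isOpen_thickening.measurableSet)
    (fun m n hmn => Metric.thickening_mono (hv_anti.antitone hmn) C)
    ⟨0, (hu.integrableOn_isCompact (hC.isBounded.cthickening (δ := v 0)).isCompact_closure).mono_set
      ((Metric.thickening_subset_cthickening _ _).trans subset_closure)⟩
  have hInter : ⋂ n, Metric.thickening (v n) C = C := by
    apply Set.Subset.antisymm
    · intro x hx
      rw [← hC.isClosed.closure_eq, Metric.closure_eq_iInter_thickening]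
      simp only [Set.mem_iInter] at hx ⊢
      intro δ hδ
      obtain ⟨n, hn⟩ := (hv_lim.eventually_lt_const hδ).exists
      exact Metric.thickening_mono hn.le C (hx n)
    · exact Set.subset_iInter fun n => Metric.self_subset_thickening (hv_pos n) C
  rw [hInter] at hlim
  refine tendsto_nhds_unique hlim ?_
  refine tendsto_const_nhds.congr fun n => ?_
  obtain ⟨a, ha0, ha⟩ := NormedField.exists_norm_lt K (hv_pos n)
  obtain ⟨R, hR⟩ := (hC.isBounded.thickening (δ := v n)).subset_closedBall (0 : K)
  obtain ⟨b, hb⟩ := NormedField.exists_lt_norm K R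
  have hinv : ∀ x y : K, ‖y‖ ≤ ‖a‖ → x ∈ Metric.thickening (v n) C →
      x + y ∈ Metric.thickening (v n) C := by
    intro x y hy hx
    rw [Metric.mem_thickening_iff] at hx ⊢
    obtain ⟨z, hz, hxz⟩ := hx
    refine ⟨z, hz, ?_⟩
    rw [dist_eq_norm] at hxz ⊢
    rw [show x + y - z = (x - z) + y by ring]
    exact (IsUltrametricDist.norm_add_le_max _ _).trans_lt (max_lt hxz (hy.trans_lt ha))
  have hmem : (Metric.thickening (v n) C).indicator (fun _ => (1 : ℂ)) ∈ TestFunction K := by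
    refine mem_testFunction_of_params (a := a) (b := b) (norm_pos_iff.1 ha0) ?_ ?_
    · intro x y hy
      have : x + y ∈ Metric.thickening (v n) C ↔ x ∈ Metric.thickening (v n) C := by
        refine ⟨fun hx => ?_, hinv x y hy⟩
        simpa using hinv (x + y) (-y) (by simpa using hy) hx
      by_cases hx : x ∈ Metric.thickening (v n) C
      · rw [Set.indicator_of_mem hx, Set.indicator_of_mem (this.2 hx)]
      · rw [Set.indicator_of_notMem hx, Set.indicator_of_notMem fun h => hx (this.1 h)]
    · intro x hx
      apply Set.indicator_of_notMem
      intro hxt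
      have := hR hxt
      rw [mem_closedBall_zero_iff] at this
      linarith
  have := h ⟨_, hmem⟩
  rw [← integral_indicator Metric.isOpen_thickening.measurableSet, ← this]
  congr 1
  ext x
  by_cases hx : x ∈ Metric.thickening (v n) C <;> simp [hx]

end Uniqueness

section Weight

variable (K : Type*) [NontriviallyNormedField K]

/-- The square root of the Sobolev weight, as a complex valued function. -/
def weight (s : ℝ) (ξ : K) : ℂ :=
  (((1 + ‖ξ‖ ^ 2) ^ (s / 2) : ℝ) : ℂ)

variable {K}

lemma weight_ne_zero (s : ℝ) (ξ : K) : weight K s ξ ≠ 0 := by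
  unfold weight
  have : (0 : ℝ) < (1 + ‖ξ‖ ^ 2) ^ (s / 2) := by positivity
  exact_mod_cast this.ne'

lemma continuous_weight (s : ℝ) : Continuous (weight K s) := by
  unfold weight
  refine Complex.continuous_ofReal.comp (Continuous.rpow_const (by fun_prop) fun ξ => Or.inl ?_)
  positivity

lemma weight_mul_conj (s : ℝ) (ξ : K) :
    weight K s ξ * conj (weight K s ξ) = (((1 + ‖ξ‖ ^ 2) ^ s : ℝ) : ℂ) := by
  unfold weight
  rw [Complex.conj_ofReal, ← Complex.ofReal_mul, ← Real.rpow_add (by positivity), add_halves]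

end Weight

section Sobolev

variable {K : Type*} [NontriviallyNormedField K] [IsUltrametricDist K] [ProperSpace K]
  [MeasurableSpace K] [BorelSpace K]

/-- The Fourier transform of a tempered distribution, `⟨T̂, f⟩ = ⟨T, f̂⟩`. -/
def TemperedDistribution.fourier (χ : StandardCharacter K) (T : TemperedDistribution K) :
    TemperedDistribution K :=
  T ∘ₗ χ.fourier

/-- The distribution `T` is the regular distribution `f ↦ ∫ u f` given by the locally integrable
function `u`. -/
def TemperedDistribution.IsRepresentedBy (T : TemperedDistribution K) (u : K → ℂ) : Prop :=
  LocallyIntegrable u (haar K) ∧ ∀ f : TestFunction K, T f = ∫ ξ, u ξ * (f : K → ℂ) ξ ∂haar K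

/-- `T` belongs to the Sobolev space of order `s`: its Fourier transform is a function `u` with
`∫ (1 + |ξ|²)^s |u(ξ)|² dξ < ∞`. -/
def MemSobolev (χ : StandardCharacter K) (s : ℝ) (T : TemperedDistribution K) : Prop :=
  ∃ u : K → ℂ, (TemperedDistribution.fourier χ T).IsRepresentedBy u ∧
    Integrable (fun ξ => (1 + ‖ξ‖ ^ 2) ^ s * ‖u ξ‖ ^ 2) (haar K)

lemma memLp_weight_iff (s : ℝ) {u : K → ℂ} (hu : LocallyIntegrable u (haar K)) :
    MemLp (fun ξ => weight K s ξ * u ξ) 2 (haar K) ↔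
      Integrable (fun ξ => (1 + ‖ξ‖ ^ 2) ^ s * ‖u ξ‖ ^ 2) (haar K) := by
  have hmeas : AEStronglyMeasurable (fun ξ => weight K s ξ * u ξ) (haar K) :=
    (continuous_weight s).aestronglyMeasurable.mul hu.aestronglyMeasurable
  rw [memLp_two_iff_integrable_sq_norm hmeas]
  apply iff_of_eq
  congr 1
  ext ξ
  have h := congrArg norm (weight_mul_conj s ξ)
  rw [norm_mul, Complex.norm_conj, Complex.norm_real, Real.norm_of_nonneg (by positivity)] at h
  rw [norm_mul, mul_pow, pow_two ‖weight K s ξ‖, h]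

lemma isRepresentedBy_unique {T : TemperedDistribution K} {u v : K → ℂ}
    (hu : T.IsRepresentedBy u) (hv : T.IsRepresentedBy v) : u =ᵐ[haar K] v := by
  have h := ae_eq_zero_of_forall_testFunction (hu.1.sub hv.1) fun f => by
    simp only [Pi.sub_apply, sub_mul]
    rw [integral_sub (integrable_mul_testFunction hu.1 f) (integrable_mul_testFunction hv.1 f),
      ← hu.2 f, ← hv.2 f, sub_self]
  filter_upwards [h] with x hx
  exact sub_eq_zero.1 hx

lemma IsRepresentedBy.add {S T : TemperedDistribution K} {u v : K → ℂ}
    (hu : S.IsRepresentedBy u) (hv : T.IsRepresentedBy v) :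
    (S + T).IsRepresentedBy (u + v) := by
  refine ⟨hu.1.add hv.1, fun f => ?_⟩
  simp only [Pi.add_apply, add_mul]
  rw [integral_add (integrable_mul_testFunction hu.1 f) (integrable_mul_testFunction hv.1 f),
    ← hu.2 f, ← hv.2 f, LinearMap.add_apply]

lemma IsRepresentedBy.smul {T : TemperedDistribution K} {u : K → ℂ} (r : ℂ)
    (hu : T.IsRepresentedBy u) : (r • T).IsRepresentedBy (r • u) := by
  refine ⟨hu.1.smul r, fun f => ?_⟩
  simp only [Pi.smul_apply, smul_eq_mul, mul_assoc]
  rw [integral_const_mul, ← hu.2 f, LinearMap.smul_apply, smul_eq_mul]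

/-- The Sobolev space as a linear subspace of the space of tempered distributions. -/
def sobolevSubmodule (χ : StandardCharacter K) (s : ℝ) : Submodule ℂ (TemperedDistribution K) where
  carrier := {T | MemSobolev χ s T}
  zero_mem' := by
    refine ⟨0, ⟨locallyIntegrable_zero, fun f => ?_⟩, ?_⟩
    · simp [TemperedDistribution.fourier]
    · simp
  add_mem' := by
    rintro S T ⟨u, hu, hui⟩ ⟨v, hv, hvi⟩
    have huv := IsRepresentedBy.add hu hv
    refine ⟨u + v, huv, (memLp_weight_iff s huv.1).1 ?_⟩
    convert ((memLp_weight_iff s hu.1).2 hui).add ((memLp_weight_iff s hv.1).2 hvi) using 1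
    ext ξ
    simp [mul_add]
  smul_mem' := by
    rintro r T ⟨u, hu, hui⟩
    have hru := IsRepresentedBy.smul r hu
    refine ⟨r • u, hru, (memLp_weight_iff s hru.1).1 ?_⟩
    convert ((memLp_weight_iff s hu.1).2 hui).const_smul r using 1
    ext ξ
    simp only [Pi.smul_apply, smul_eq_mul]
    ring

/-- The Sobolev space `H^s(K)`. -/
def Sobolev (χ : StandardCharacter K) (s : ℝ) : Type _ := sobolevSubmodule χ s

namespace Sobolev

variable {χ : StandardCharacter K} {s : ℝ}

instance : AddCommGroup (Sobolev χ s) := inferInstanceAs (AddCommGroup (sobolevSubmodule χ s))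

instance : Module ℂ (Sobolev χ s) := inferInstanceAs (Module ℂ (sobolevSubmodule χ s))

/-- The tempered distribution underlying an element of the Sobolev space. -/
def toDistribution : Sobolev χ s →ₗ[ℂ] TemperedDistribution K := (sobolevSubmodule χ s).subtype

lemma toDistribution_injective :
    Function.Injective (toDistribution : Sobolev χ s → TemperedDistribution K) :=
  Subtype.val_injective

lemma memSobolev (T : Sobolev χ s) : MemSobolev χ s (toDistribution T) := Subtype.property T

/-- The Fourier transform of an element of the Sobolev space, as a function on `K` (determined
almost everywhere). -/
def hat (T : Sobolev χ s) : K → ℂ := T.memSobolev.choose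

lemma isRepresentedBy_hat (T : Sobolev χ s) :
    (TemperedDistribution.fourier χ (toDistribution T)).IsRepresentedBy T.hat :=
  T.memSobolev.choose_spec.1

lemma integrable_hat (T : Sobolev χ s) :
    Integrable (fun ξ => (1 + ‖ξ‖ ^ 2) ^ s * ‖T.hat ξ‖ ^ 2) (haar K) :=
  T.memSobolev.choose_spec.2

lemma hat_add (S T : Sobolev χ s) : (S + T).hat =ᵐ[haar K] S.hat + T.hat :=
  isRepresentedBy_unique (S + T).isRepresentedBy_hat
    (IsRepresentedBy.add S.isRepresentedBy_hat T.isRepresentedBy_hat)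

lemma hat_smul (r : ℂ) (T : Sobolev χ s) : (r • T).hat =ᵐ[haar K] r • T.hat :=
  isRepresentedBy_unique (r • T).isRepresentedBy_hat
    (IsRepresentedBy.smul r T.isRepresentedBy_hat)

lemma memLp_hat (T : Sobolev χ s) : MemLp (fun ξ => weight K s ξ * T.hat ξ) 2 (haar K) :=
  (memLp_weight_iff s T.isRepresentedBy_hat.1).2 T.integrable_hat

/-- The map `T ↦ (1 + |ξ|²)^{s/2} T̂` to `L²(K)`. -/
def toL2 : Sobolev χ s →ₗ[ℂ] Lp ℂ 2 (haar K) where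
  toFun T := T.memLp_hat.toLp _
  map_add' S T := by
    rw [← MemLp.toLp_add, MemLp.toLp_eq_toLp_iff]
    filter_upwards [hat_add S T] with ξ hξ
    simp [hξ, mul_add]
  map_smul' r T := by
    rw [RingHom.id_apply, ← MemLp.toLp_const_smul, MemLp.toLp_eq_toLp_iff]
    filter_upwards [hat_smul r T] with ξ hξ
    simp only [hξ, Pi.smul_apply, smul_eq_mul]
    ring

lemma coeFn_toL2 (T : Sobolev χ s) :
    (toL2 T : K → ℂ) =ᵐ[haar K] fun ξ => weight K s ξ * T.hat ξ :=
  T.memLp_hat.coeFn_toLp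

lemma fourier_pow_four (f : TestFunction K) :
    χ.fourier (χ.fourier (χ.fourier (χ.fourier f))) = f := by
  apply Subtype.ext
  ext x
  rw [StandardCharacter.fourier_fourier, StandardCharacter.fourier_fourier, neg_neg]

lemma toL2_injective : Function.Injective (toL2 : Sobolev χ s → Lp ℂ 2 (haar K)) := by
  rw [injective_iff_map_eq_zero]
  intro T hT
  apply toDistribution_injective
  rw [map_zero]
  have h0 : T.hat =ᵐ[haar K] 0 := by
    have h1 := coeFn_toL2 T
    rw [hT] at h1
    filter_upwards [h1, Lp.coeFn_zero ℂ 2 (haar K)] with ξ h2 h3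
    rw [h3] at h2
    exact (mul_eq_zero.1 h2.symm).resolve_left (weight_ne_zero s ξ)
  ext f
  have h := T.isRepresentedBy_hat.2 (χ.fourier (χ.fourier (χ.fourier f)))
  rw [TemperedDistribution.fourier, LinearMap.comp_apply, fourier_pow_four] at h
  rw [h, LinearMap.zero_apply]
  apply integral_eq_zero_of_ae
  filter_upwards [h0] with ξ hξ
  simp [hξ]

lemma toL2_surjective : Function.Surjective (toL2 : Sobolev χ s → Lp ℂ 2 (haar K)) := by
  intro v
  set u : K → ℂ := fun ξ => (weight K s ξ)⁻¹ * v ξ with hu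
  have hul : LocallyIntegrable u (haar K) :=
    ((Lp.memLp v).locallyIntegrable one_le_two).continuous_mul
      ((continuous_weight s).inv₀ (weight_ne_zero s))
  let R : TemperedDistribution K :=
    { toFun := fun f => ∫ ξ, u ξ * (f : K → ℂ) ξ ∂haar K
      map_add' := fun f g => by
        rw [← integral_add (integrable_mul_testFunction hul f) (integrable_mul_testFunction hul g)]
        congr 1
        ext ξ
        simp [mul_add]
      map_smul' := fun r f => by
        rw [RingHom.id_apply, smul_eq_mul, ← integral_const_mul]
        congr 1
        ext ξ
        simp only [SetLike.val_smul, Pi.smul_apply, smul_eq_mul]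
        ring }
  let T : TemperedDistribution K := R ∘ₗ χ.fourier ∘ₗ χ.fourier ∘ₗ χ.fourier
  have hT : (TemperedDistribution.fourier χ T).IsRepresentedBy u := by
    refine ⟨hul, fun f => ?_⟩
    change R (χ.fourier (χ.fourier (χ.fourier (χ.fourier f)))) = _
    rw [fourier_pow_four]
    rfl
  have hwu : (fun ξ => weight K s ξ * u ξ) = v := by
    ext ξ
    rw [hu, mul_inv_cancel_left₀ (weight_ne_zero s ξ)]
  have hmem : MemSobolev χ s T := ⟨u, hT, (memLp_weight_iff s hul).1 (hwu ▸ Lp.memLp v)⟩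
  let S : Sobolev χ s := ⟨T, hmem⟩
  refine ⟨S, ?_⟩
  apply Lp.ext
  have h1 : S.hat =ᵐ[haar K] u := isRepresentedBy_unique S.isRepresentedBy_hat hT
  filter_upwards [coeFn_toL2 S, h1] with ξ h2 h3
  rw [h2, h3]
  exact congrFun hwu ξ

/-- The inner product `∫ (1 + |ξ|²)^s conj (Ŝ(ξ)) T̂(ξ) dξ` (conjugate linear in the first
variable, as always in Mathlib). -/
def sobolevInner (S T : Sobolev χ s) : ℂ :=
  ∫ ξ, (((1 + ‖ξ‖ ^ 2) ^ s : ℝ) : ℂ) * (conj (S.hat ξ) * T.hat ξ) ∂haar K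

lemma sobolevInner_eq_inner_toL2 (S T : Sobolev χ s) :
    sobolevInner S T = inner ℂ (toL2 S) (toL2 T) := by
  rw [L2.inner_def]
  apply integral_congr_ae
  filter_upwards [coeFn_toL2 S, coeFn_toL2 T] with ξ h1 h2
  rw [h1, h2, RCLike.inner_apply, ← weight_mul_conj, map_mul]
  ring

/-- The inner product axioms. -/
abbrev core (χ : StandardCharacter K) (s : ℝ) : InnerProductSpace.Core ℂ (Sobolev χ s) where
  inner := sobolevInner
  conj_inner_symm S T := by
    rw [sobolevInner_eq_inner_toL2, sobolevInner_eq_inner_toL2, inner_conj_symm]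
  re_inner_nonneg T := by
    rw [sobolevInner_eq_inner_toL2]
    exact inner_self_nonneg
  add_left S T U := by
    simp only [sobolevInner_eq_inner_toL2, map_add, inner_add_left]
  smul_left S T r := by
    simp only [sobolevInner_eq_inner_toL2, map_smul, inner_smul_left]
  definite T hT := by
    rw [sobolevInner_eq_inner_toL2, inner_self_eq_zero] at hT
    exact toL2_injective (hT.trans (map_zero _).symm)

instance : NormedAddCommGroup (Sobolev χ s) := (core χ s).toNormedAddCommGroup

instance : InnerProductSpace ℂ (Sobolev χ s) := InnerProductSpace.ofCore (core χ s).toCore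

lemma inner_def (S T : Sobolev χ s) : inner ℂ S T =
    ∫ ξ, (((1 + ‖ξ‖ ^ 2) ^ s : ℝ) : ℂ) * (conj (S.hat ξ) * T.hat ξ) ∂haar K :=
  rfl

lemma norm_toL2 (T : Sobolev χ s) : ‖toL2 T‖ = ‖T‖ := by
  have h : inner ℂ T T = inner ℂ (toL2 T) (toL2 T) := sobolevInner_eq_inner_toL2 T T
  rw [inner_self_eq_norm_sq_to_K, inner_self_eq_norm_sq_to_K] at h
  have h' : ‖T‖ ^ 2 = ‖toL2 T‖ ^ 2 := by exact_mod_cast h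
  exact ((pow_left_inj₀ (norm_nonneg _) (norm_nonneg _) two_ne_zero).1 h').symm

/-- `H^s(K)` is isometric to `L²(K)`. -/
def equivL2 : Sobolev χ s ≃ₗᵢ[ℂ] Lp ℂ 2 (haar K) where
  toLinearEquiv := LinearEquiv.ofBijective toL2 ⟨toL2_injective, toL2_surjective⟩
  norm_map' := norm_toL2

instance : CompleteSpace (Sobolev χ s) :=
  (equivL2 (χ := χ) (s := s)).toIsometryEquiv.completeSpace_iff.2 inferInstance

/-- The norm satisfies `‖T‖² = ∫ (1 + |ξ|²)^s |T̂(ξ)|² dξ`. -/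
lemma norm_sq_eq (T : Sobolev χ s) :
    ‖T‖ ^ 2 = ∫ ξ, (1 + ‖ξ‖ ^ 2) ^ s * ‖T.hat ξ‖ ^ 2 ∂haar K := by
  have h : ((‖T‖ ^ 2 : ℝ) : ℂ) = inner ℂ T T := by
    rw [inner_self_eq_norm_sq_to_K]
    push_cast
    rfl
  rw [inner_def] at h
  have h2 : ∀ ξ, (((1 + ‖ξ‖ ^ 2) ^ s : ℝ) : ℂ) * (conj (T.hat ξ) * T.hat ξ) =
      (((1 + ‖ξ‖ ^ 2) ^ s * ‖T.hat ξ‖ ^ 2 : ℝ) : ℂ) := by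
    intro ξ
    rw [Complex.conj_mul']
    push_cast
    rfl
  simp only [h2] at h
  rw [integral_complex_ofReal] at h
  exact_mod_cast h

end Sobolev

/-- The closed linear span of a sequence in the Sobolev space. -/
abbrev closedSpan {χ : StandardCharacter K} {s : ℝ} (Φ : ℕ → Sobolev χ s) :
    Submodule ℂ (Sobolev χ s) :=
  (Submodule.span ℂ (Set.range Φ)).topologicalClosure

end Sobolev

end LocalFieldMRA

end

open LocalFieldMRA

/-! Everything happens on the Fourier side. Multiplying the transform by the square root of the
weight makes `Sobolev χ s` into L², and with `a = ϖ ^ (-j)` each `Φ j k` becomes the character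
`χ(-λ(k) a⁻¹ ξ)` times a function `profile` independent of `k`. So the inner products of `h` with
the orthonormal system are Fourier coefficients of `conj profile * h.weighted` at the frequencies
`λ(k) a⁻¹`, and `‖P_j h‖²` is the sum of their squared moduli.

The elements `λ(k)` represent each coset of the ring of integers exactly once
(`one_lt_norm_translation_sub`, `exists_norm_sub_translation_le_one`). Hence these characters form a
complete orthogonal system on every ball of radius `‖a‖`, and remain orthogonal, though possibly
incomplete, on larger balls centred at the origin. Parseval on the small ball shows that `‖P_j h‖²`
equals the integral of the theorem when `h` has frequencies in `‖ξ‖ ≤ ‖a‖`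
(`norm_starProjection_sq_eq`). Applied to indicator functions and combined with Bessel for the
orthonormal system, it also yields `‖a‖ * ‖profile‖² ≤ 1` almost everywhere (`norm_profile_sq_le`),
so the integral is finite and at most `‖h‖²`. For general `h`, discarding the frequencies beyond
`‖a‖` changes both quantities by at most a multiple of `‖h‖` times the norm of the discarded tail,
which vanishes as `j → +∞`.

For the intersection, let `j → -∞`. If the transform of `g` is bounded and lives on an annulus,
Bessel on a fixed ball containing it bounds `‖P_j g‖²` by a constant times `(‖a‖ / r) ^ (2θ)`,
because after rescaling only far frequencies of `φ j` meet the annulus and the moment hypothesis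
controls them. An `h` in all the spaces satisfies `⟨g, h⟩ = ⟨P_j g, h⟩ → 0`. Taking for `g`
truncations of `h` itself forces `h = 0`. -/

noncomputable section

namespace LocalFieldMRA

/-! ### Digit expansions: the `λ(k)` as coset representatives of the ring of integers -/

section Arithmetic

variable {K : Type*} [NontriviallyNormedField K] [IsUltrametricDist K] {p c : ℕ}

lemma residue_eq_zero_iff_norm_lt_one (x : 𝒪[K]) :
    IsLocalRing.residue 𝒪[K] x = 0 ↔ ‖(x : K)‖ < 1 := by
  rw [IsLocalRing.residue_eq_zero_iff, IsLocalRing.mem_maximalIdeal, mem_nonunits_iff,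
    Valued.integer.isUnit_iff_norm_eq_one]
  have h := Valued.integer.norm_le_one x
  exact ⟨fun hx => lt_of_le_of_ne h hx, fun hx => hx.ne⟩

/-- The integer `∑ u_i e_i` attached to the base `p` digits `u_i` of `n`. -/
def digitSum (p : ℕ) (e : Fin c → 𝒪[K]) (n : ℕ) : 𝒪[K] :=
  ∑ i : Fin c, ((n / p ^ (i : ℕ) % p : ℕ) : 𝒪[K]) * e i

lemma translationDigit_eq (ϖ : K) (e : Fin c → 𝒪[K]) (n : ℕ) :
    translationDigit p ϖ e n = (digitSum p e n : K) * ϖ⁻¹ := by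
  simp [translationDigit, digitSum]

lemma translationDigit_zero (ϖ : K) (e : Fin c → 𝒪[K]) : translationDigit p ϖ e 0 = 0 := by
  simp [translationDigit]

/-- Digits of index beyond `n` vanish since `n < q ^ n`. The freedom in the cutoff is what lets `n`
and `n / q` be compared in the recursion below. -/
lemma translation_eq_sum (hq : 1 < p ^ c) (ϖ : K) (e : Fin c → 𝒪[K]) {n N : ℕ} (hN : n ≤ N) :
    translation p ϖ e n = ∑ k ∈ Finset.range (N + 1),
      (ϖ⁻¹) ^ k * translationDigit p ϖ e (n / (p ^ c) ^ k % p ^ c) := by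
  unfold translation
  apply Finset.sum_subset
  · intro k hk
    simp only [Finset.mem_range] at hk ⊢
    omega
  · intro k _ hk
    simp only [Finset.mem_range] at hk
    have h1 : n < (p ^ c) ^ k := lt_of_lt_of_le (by omega) (Nat.lt_pow_self hq).le
    rw [Nat.div_eq_of_lt h1, Nat.zero_mod, translationDigit_zero, mul_zero]

lemma translation_rec (hq : 1 < p ^ c) (ϖ : K) (e : Fin c → 𝒪[K]) (n : ℕ) :
    translation p ϖ e n =
      translationDigit p ϖ e (n % p ^ c) + ϖ⁻¹ * translation p ϖ e (n / p ^ c) := by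
  rw [translation_eq_sum hq ϖ e (Nat.le_succ n), Finset.sum_range_succ',
    translation_eq_sum hq ϖ e (Nat.div_le_self n (p ^ c)), Finset.mul_sum, add_comm]
  congr 1
  · simp
  · refine Finset.sum_congr rfl fun k _ => ?_
    rw [pow_succ', pow_succ', mul_assoc, Nat.div_div_eq_div_mul]

lemma translation_zero (ϖ : K) (e : Fin c → 𝒪[K]) : translation p ϖ e 0 = 0 := by
  simp [translation, translationDigit_zero]

variable [Fact p.Prime] [Algebra (ZMod p) 𝓀[K]] (e : Fin c → 𝒪[K])
  (b : Module.Basis (Fin c) (ZMod p) 𝓀[K]) (hb : ∀ i, b i = IsLocalRing.residue 𝒪[K] (e i))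

include hb in
lemma residue_digitSum (n : ℕ) :
    IsLocalRing.residue 𝒪[K] (digitSum p e n) =
      b.equivFun.symm fun i => ((n / p ^ (i : ℕ) % p : ℕ) : ZMod p) := by
  rw [Module.Basis.equivFun_symm_apply, digitSum, map_sum]
  refine Finset.sum_congr rfl fun i _ => ?_
  rw [map_mul, map_natCast, hb, Algebra.smul_def, map_natCast]

include hb in
-- The base `p` digits are the coordinates of the residue in the basis `b`, and below `p ^ c` they
-- determine the number. Distinct numbers thus have distinct residues, and their difference is a
-- unit.
lemma norm_digitSum_sub {m n : ℕ} (hm : m < p ^ c) (hn : n < p ^ c) (hmn : m ≠ n) :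
    ‖(digitSum p e m : K) - digitSum p e n‖ = 1 := by
  refine le_antisymm (Valued.integer.norm_le_one (digitSum p e m - digitSum p e n)) ?_
  by_contra! hlt
  have h0 := (residue_eq_zero_iff_norm_lt_one (digitSum p e m - digitSum p e n)).2 hlt
  rw [map_sub, sub_eq_zero, residue_digitSum e b hb, residue_digitSum e b hb] at h0
  have h1 := b.equivFun.symm.injective h0
  apply hmn
  have h2 : finFunctionFinEquiv.symm (⟨m, hm⟩ : Fin (p ^ c)) =
      finFunctionFinEquiv.symm (⟨n, hn⟩ : Fin (p ^ c)) := by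
    ext i
    have h3 := congrFun h1 i
    rw [ZMod.natCast_eq_natCast_iff, Nat.ModEq, Nat.mod_mod, Nat.mod_mod] at h3
    exact h3
  exact congrArg Fin.val (finFunctionFinEquiv.symm.injective h2)

include hb in
lemma exists_norm_sub_digitSum_lt_one {x : K} (hx : ‖x‖ ≤ 1) :
    ∃ n < p ^ c, ‖x - digitSum p e n‖ < 1 := by
  let y : 𝒪[K] := ⟨x, Valued.integer.mem_iff.2 hx⟩
  let f : Fin c → Fin p := fun i =>
    ⟨(b.equivFun (IsLocalRing.residue 𝒪[K] y) i).val, ZMod.val_lt _⟩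
  refine ⟨finFunctionFinEquiv f, (finFunctionFinEquiv f).2, ?_⟩
  refine (residue_eq_zero_iff_norm_lt_one (y - digitSum p e (finFunctionFinEquiv f))).1 ?_
  rw [map_sub, sub_eq_zero, residue_digitSum e b hb, LinearEquiv.eq_symm_apply]
  ext i
  have h : (finFunctionFinEquiv f : ℕ) / p ^ (i : ℕ) % p = (f i : ℕ) :=
    congrArg Fin.val (congrFun (finFunctionFinEquiv.symm_apply_apply f) i)
  rw [h, ZMod.natCast_val, ZMod.cast_id', id]

include hb in
-- Induction on `m + n`, peeling off the lowest base `q` digit. If the quotients agree, the lowest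
-- digits differ by a unit and the norm is `‖ϖ‖⁻¹`. Otherwise the difference of the quotients'
-- translations already exceeds 1 and dominates the digit difference ultrametrically.
lemma one_lt_norm_translation_sub {ϖ : K} (hϖ : IsPrimeElement ϖ) (hq : 1 < p ^ c) {m n : ℕ}
    (hmn : m ≠ n) : 1 < ‖translation p ϖ e m - translation p ϖ e n‖ := by
  have hpos : 0 < ‖ϖ‖ := norm_pos_iff.2 hϖ.ne_zero
  have hinv : 1 < ‖ϖ‖⁻¹ := (one_lt_inv₀ hpos).2 hϖ.norm_lt_one
  have key : ∀ N m n : ℕ, m + n < N → m ≠ n →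
      1 < ‖translation p ϖ e m - translation p ϖ e n‖ := by
    intro N
    induction N with
    | zero => intro m n h; omega
    | succ N ih =>
      intro m n h hmn
      rw [translation_rec hq ϖ e m, translation_rec hq ϖ e n, translationDigit_eq,
        translationDigit_eq, show ∀ x y z w : K, x * ϖ⁻¹ + ϖ⁻¹ * y - (z * ϖ⁻¹ + ϖ⁻¹ * w) =
          ϖ⁻¹ * ((x - z) + (y - w)) from fun x y z w => by ring, norm_mul, norm_inv]
      have hlt : 0 < p ^ c := by omega
      by_cases hd : m / p ^ c = n / p ^ c
      · have hmod : m % p ^ c ≠ n % p ^ c := by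
          intro h'
          exact hmn (by rw [← Nat.div_add_mod m (p ^ c), ← Nat.div_add_mod n (p ^ c), hd, h'])
        rw [hd, sub_self, add_zero, norm_digitSum_sub e b hb (Nat.mod_lt _ hlt)
          (Nat.mod_lt _ hlt) hmod, mul_one]
        exact hinv
      · have hdiv : m / p ^ c + n / p ^ c < N := by
          rcases Nat.eq_zero_or_pos m with rfl | hm
          · rcases Nat.eq_zero_or_pos n with rfl | hn
            · omega
            · have := Nat.div_lt_self hn hq
              simp only [Nat.zero_div]; omega
          · have := Nat.div_lt_self hm hq
            have := Nat.div_le_self n (p ^ c)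
            omega
        have h1 := ih _ _ hdiv hd
        have h2 : ‖(digitSum p e (m % p ^ c) : K) - digitSum p e (n % p ^ c)‖ ≤ 1 :=
          Valued.integer.norm_le_one (digitSum p e (m % p ^ c) - digitSum p e (n % p ^ c))
        rw [IsUltrametricDist.norm_add_eq_max_of_norm_ne_norm (by linarith),
          max_eq_right (by linarith)]
        exact one_lt_mul_of_lt_of_le hinv h1.le
  exact key _ m n (Nat.lt_succ_self _) hmn

include hb in
-- Induction on a power of `ϖ` that brings `x` into the unit ball: approximate `ϖ * x` by `λ(m)`,
-- correct the integral remainder modulo the prime ideal by one digit `v`, and divide by `ϖ`. The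
-- index is `v + q * m`.
lemma exists_norm_sub_translation_le_one {ϖ : K} (hϖ : IsPrimeElement ϖ) (hq : 1 < p ^ c)
    (x : K) : ∃ n, ‖x - translation p ϖ e n‖ ≤ 1 := by
  have hpos : 0 < ‖ϖ‖ := norm_pos_iff.2 hϖ.ne_zero
  have key : ∀ (N : ℕ) (x : K), ‖ϖ ^ N * x‖ ≤ 1 → ∃ n, ‖x - translation p ϖ e n‖ ≤ 1 := by
    intro N
    induction N with
    | zero => intro x hx; exact ⟨0, by simpa [translation_zero] using hx⟩
    | succ N ih =>
      intro x hx
      obtain ⟨m, hm⟩ := ih (ϖ * x) (by rwa [← mul_assoc, ← pow_succ])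
      obtain ⟨v, hv, hvx⟩ := exists_norm_sub_digitSum_lt_one e b hb hm
      refine ⟨v + p ^ c * m, ?_⟩
      have hlt : 0 < p ^ c := by omega
      rw [translation_rec hq, Nat.add_mul_mod_self_left, Nat.mod_eq_of_lt hv,
        Nat.add_mul_div_left _ _ hlt, Nat.div_eq_of_lt hv, zero_add, translationDigit_eq]
      have h1 := hϖ.norm_le _ hvx
      have h2 : x - (digitSum p e v * ϖ⁻¹ + ϖ⁻¹ * translation p ϖ e m) =
          ϖ⁻¹ * (ϖ * x - translation p ϖ e m - digitSum p e v) := by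
        have := hϖ.ne_zero
        field_simp
        ring
      rw [h2, norm_mul, norm_inv]
      exact (inv_mul_le_one₀ hpos).2 h1
  obtain ⟨N, hN⟩ := exists_pow_lt_of_lt_one (show (0 : ℝ) < (‖x‖ + 1)⁻¹ by positivity)
    hϖ.norm_lt_one
  refine key N x ?_
  rw [norm_mul, norm_pow]
  have hx := norm_nonneg x
  calc ‖ϖ‖ ^ N * ‖x‖ ≤ (‖x‖ + 1)⁻¹ * (‖x‖ + 1) := by gcongr; linarith
    _ = 1 := inv_mul_cancel₀ (by positivity)

end Arithmetic

/-! ### The module of multiplication by powers of the prime element -/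

section HaarScaling

lemma haar_closedBall_one {K : Type*} [NontriviallyNormedField K] [ProperSpace K]
    [MeasurableSpace K] [BorelSpace K] : haar K (Metric.closedBall 0 1) = 1 :=
  Measure.addHaarMeasure_self

lemma smul_closedBall_one {K : Type*} [NontriviallyNormedField K] (u : Kˣ) :
    u • (Metric.closedBall (0 : K) 1) = Metric.closedBall 0 ‖(u : K)‖ := by
  ext x
  have hu : 0 < ‖(u : K)‖ := norm_pos_iff.2 u.ne_zero
  rw [Set.mem_smul_set_iff_inv_smul_mem, mem_closedBall_zero_iff, mem_closedBall_zero_iff,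
    Units.smul_def, smul_eq_mul, norm_mul, Units.val_inv_eq_inv_val, norm_inv,
    inv_mul_le_iff₀ hu, mul_one]

variable {K : Type*} [NontriviallyNormedField K] [IsUltrametricDist K] [ProperSpace K]
  [MeasurableSpace K] [BorelSpace K] {p c : ℕ}

/-- The ring of integers is the disjoint union of `q` translates of the prime ideal. -/
lemma haar_closedBall_prime [Fact p.Prime] [Algebra (ZMod p) 𝓀[K]] (e : Fin c → 𝒪[K])
    (b : Module.Basis (Fin c) (ZMod p) 𝓀[K]) (hb : ∀ i, b i = IsLocalRing.residue 𝒪[K] (e i))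
    {ϖ : K} (hϖ : IsPrimeElement ϖ) :
    (p ^ c : ℕ) * haar K (Metric.closedBall 0 ‖ϖ‖) = 1 := by
  have hU : Metric.closedBall (0 : K) 1 =
      ⋃ n ∈ Finset.range (p ^ c), Metric.closedBall (digitSum p e n : K) ‖ϖ‖ := by
    ext x
    simp only [Set.mem_iUnion, Finset.mem_range, exists_prop, Metric.mem_closedBall,
      dist_eq_norm, sub_zero]
    constructor
    · intro hx
      obtain ⟨n, hn, h⟩ := exists_norm_sub_digitSum_lt_one e b hb hx
      exact ⟨n, hn, hϖ.norm_le _ h⟩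
    · rintro ⟨n, -, h⟩
      have h1 : ‖(digitSum p e n : K)‖ ≤ 1 := Valued.integer.norm_le_one _
      have := IsUltrametricDist.norm_add_le_max (x - digitSum p e n) (digitSum p e n : K)
      rw [sub_add_cancel] at this
      exact this.trans (max_le (h.trans hϖ.norm_lt_one.le) h1)
  rw [← haar_closedBall_one (K := K), hU, measure_biUnion_finset]
  · simp only [Measure.addHaar_closedBall_center, Finset.sum_const, Finset.card_range,
      nsmul_eq_mul]
  · intro m hm n hn hmn
    simp only [Finset.coe_range, Set.mem_Iio] at hm hn
    rw [Function.onFun, Set.disjoint_left]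
    intro x hxm hxn
    have h := norm_digitSum_sub e b hb hm hn hmn
    rw [Metric.mem_closedBall, dist_eq_norm] at hxm hxn
    rw [norm_sub_rev] at hxm
    have h2 := IsUltrametricDist.norm_add_le_max ((digitSum p e m : K) - x) (x - digitSum p e n)
    rw [sub_add_sub_cancel, h] at h2
    linarith [max_le hxm hxn, hϖ.norm_lt_one]
  · exact fun n _ => Metric.isClosed_closedBall.measurableSet

/-- The normalization `‖ϖ‖ = q⁻¹` enters here: it matches the mass of the prime ideal, one of `q`
disjoint translates filling the unit ball. Multiplicativity then covers all powers. -/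
lemma distribHaarChar_zpow [Fact p.Prime] [Algebra (ZMod p) 𝓀[K]] (e : Fin c → 𝒪[K])
    (b : Module.Basis (Fin c) (ZMod p) 𝓀[K]) (hb : ∀ i, b i = IsLocalRing.residue 𝒪[K] (e i))
    {ϖ : K} (hϖ : IsPrimeElement ϖ) (hnorm : ‖ϖ‖ = ((p : ℝ) ^ c)⁻¹) (j : ℤ) :
    distribHaarChar K (Units.mk0 ϖ hϖ.ne_zero ^ j) = ‖ϖ ^ j‖₊ := by
  have h1 : distribHaarChar K (Units.mk0 ϖ hϖ.ne_zero) = ‖ϖ‖₊ := by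
    apply distribHaarChar_eq_of_measure_smul_eq_mul (μ := haar K) (s := Metric.closedBall 0 1)
    · simp [haar_closedBall_one]
    · simp [haar_closedBall_one]
    · rw [smul_closedBall_one, Units.val_mk0, haar_closedBall_one, mul_one]
      have h := haar_closedBall_prime e b hb hϖ
      rw [mul_comm] at h
      have hp : p ≠ 0 := (Fact.out : p.Prime).ne_zero
      have h2 : ‖ϖ‖₊ = ((p ^ c : ℕ) : ℝ≥0)⁻¹ := by
        ext
        push_cast
        exact hnorm
      rw [ENNReal.eq_inv_of_mul_eq_one_left h, h2, ENNReal.coe_inv (by positivity),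
        ENNReal.coe_natCast]
  rw [map_zpow, h1, nnnorm_zpow]

end HaarScaling

/-! ### Change of variables under dilations -/

section Scaling

variable {K : Type*} [NontriviallyNormedField K] [ProperSpace K] [MeasurableSpace K] [BorelSpace K]

/-- The Haar measure scales under multiplication by `a` as prescribed by the absolute value. -/
def HaarScales (a : K) : Prop :=
  (haar K).map (fun x => a * x) = ENNReal.ofReal ‖a‖⁻¹ • haar K

lemma haarScales_of_distribHaarChar (u : Kˣ) (hu : distribHaarChar K u = ‖(u : K)‖₊) :
    HaarScales (u : K) := by
  ext S hS
  rw [Measure.map_apply (by fun_prop) hS, Measure.smul_apply, smul_eq_mul]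
  have hpre : (fun x => (u : K) * x) ⁻¹' S = u⁻¹ • S := by
    ext x
    rw [Set.mem_smul_set_iff_inv_smul_mem, inv_inv, Units.smul_def, smul_eq_mul, Set.mem_preimage]
  rw [hpre, ← distribHaarChar_mul (haar K), map_inv, hu, ← nnnorm_inv]
  rw [← norm_inv, ← coe_nnnorm, ENNReal.ofReal_coe_nnreal]

variable {a : K}

lemma measurableEmbedding_mul_left {K : Type*} [NontriviallyNormedField K] [MeasurableSpace K]
    [BorelSpace K] {a : K} (ha : a ≠ 0) : MeasurableEmbedding fun x : K => a * x :=
  (Homeomorph.mulLeft₀ a ha).measurableEmbedding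

lemma HaarScales.integral_comp (h : HaarScales a) (ha : a ≠ 0) {E : Type*}
    [NormedAddCommGroup E] [NormedSpace ℝ E] (f : K → E) :
    ∫ x, f (a * x) ∂haar K = ‖a‖⁻¹ • ∫ x, f x ∂haar K := by
  rw [← (measurableEmbedding_mul_left ha).integral_map, h, integral_smul_measure,
    ENNReal.toReal_ofReal (by positivity)]

lemma HaarScales.integrable_comp (h : HaarScales a) (ha : a ≠ 0) {E : Type*}
    [NormedAddCommGroup E] {f : K → E} (hf : Integrable f (haar K)) :
    Integrable (fun x => f (a * x)) (haar K) := by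
  refine (measurableEmbedding_mul_left ha).integrable_map_iff.1 ?_
  rw [h]
  exact hf.smul_measure ENNReal.ofReal_ne_top

lemma HaarScales.locallyIntegrable_comp (h : HaarScales a) (ha : a ≠ 0) {f : K → ℂ}
    (hf : LocallyIntegrable f (haar K)) : LocallyIntegrable (fun x => f (a * x)) (haar K) := by
  refine (locallyIntegrable_map_homeomorph (Homeomorph.mulLeft₀ a ha)).1 ?_
  change LocallyIntegrable f ((haar K).map fun x => a * x)
  rw [h]
  intro x
  obtain ⟨U, hU, hfU⟩ := hf x
  refine ⟨U, hU, ?_⟩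
  rw [IntegrableOn, Measure.restrict_smul]
  exact Integrable.smul_measure hfU ENNReal.ofReal_ne_top

/-- The preimage of the ball under multiplication by `a` is the unit ball, of mass 1. This turns the
volume factor in Parseval into the factor `‖a‖`. -/
lemma HaarScales.haar_closedBall (h : HaarScales a) (ha : a ≠ 0) :
    (haar K).real (Metric.closedBall 0 ‖a‖) = ‖a‖ := by
  have hpre : (fun x => a * x) ⁻¹' Metric.closedBall 0 ‖a‖ = Metric.closedBall (0 : K) 1 := by
    ext x
    have := norm_pos_iff.2 ha
    simp [this]
  have h1 := Measure.map_apply (μ := haar K) (f := fun x => a * x) (by fun_prop)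
    (Metric.isClosed_closedBall (x := (0 : K)) (ε := ‖a‖)).measurableSet
  rw [hpre, h, haar_closedBall_one, Measure.smul_apply, smul_eq_mul] at h1
  have h2 := congrArg ENNReal.toReal h1
  rw [ENNReal.toReal_mul, ENNReal.toReal_ofReal (by positivity), ENNReal.toReal_one] at h2
  have := norm_pos_iff.2 ha
  rw [measureReal_def]
  field_simp at h2
  exact h2

lemma haar_closedBall_pos {d : K} (hd : d ≠ 0) :
    0 < (haar K).real (Metric.closedBall 0 ‖d‖) := by
  refine ENNReal.toReal_pos ?_ (isCompact_closedBall _ _).measure_ne_top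
  exact (Metric.measure_closedBall_pos _ _ (norm_pos_iff.2 hd)).ne'

end Scaling

/-! ### Fourier transform of dilated and translated distributions -/

section FourierAffine

lemma StandardCharacter.isLocallyConstant {K : Type*} [NontriviallyNormedField K]
    [IsUltrametricDist K] (χ : StandardCharacter K) :
    IsLocallyConstant fun x : K => (χ.toAddChar x : ℂ) := by
  rw [IsLocallyConstant.iff_exists_open]
  intro x
  refine ⟨Metric.ball x 1, Metric.isOpen_ball, Metric.mem_ball_self one_pos, fun y hy => ?_⟩
  rw [Metric.mem_ball, dist_eq_norm] at hy
  rw [show y = x + (y - x) by ring, AddChar.map_add_eq_mul, χ.eq_one_of_norm_le_one _ hy.le,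
    mul_one]

variable {K : Type*} [NontriviallyNormedField K] [ProperSpace K] [MeasurableSpace K] [BorelSpace K]
  [IsUltrametricDist K]

/-- The test function `ξ ↦ f (a ξ) χ(-b ξ)`. -/
def modulate (χ : StandardCharacter K) (a b : K) (ha : a ≠ 0) (f : TestFunction K) :
    TestFunction K :=
  ⟨fun ξ => (f : K → ℂ) (a * ξ) * (χ.toAddChar (-(b * ξ)) : ℂ),
    (f.2.1.comp_continuous (by fun_prop : Continuous fun ξ : K => a * ξ)).mul
      (χ.isLocallyConstant.comp_continuous (by fun_prop : Continuous fun ξ : K => -(b * ξ))),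
    (f.2.2.comp_homeomorph (Homeomorph.mulLeft₀ a ha)).mul_right⟩

/-- Substitute `y = a * ξ` in the Fourier integral; the shift by `b` splits off as a character. -/
lemma fourier_modulate (χ : StandardCharacter K) {a : K} (b : K) (ha : a ≠ 0)
    (h : HaarScales a) (f : TestFunction K) :
    TestFunction.affine a b ha (χ.fourier f) = ((‖a‖ : ℝ) : ℂ) • χ.fourier (modulate χ a b ha f) := by
  ext x
  have h1 := h.integral_comp ha fun y => (f : K → ℂ) y * (χ.toAddChar (-(a⁻¹ * (x + b) * y)) : ℂ)
  have ha' : ‖a‖ ≠ 0 := norm_ne_zero_iff.2 ha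
  rw [eq_inv_smul_iff₀ ha'] at h1
  change ∫ y, (f : K → ℂ) y * (χ.toAddChar (-(a⁻¹ * (x + b) * y)) : ℂ) ∂haar K =
    ((‖a‖ : ℝ) : ℂ) * ∫ ξ, (f : K → ℂ) (a * ξ) * (χ.toAddChar (-(b * ξ)) : ℂ) *
      (χ.toAddChar (-(x * ξ)) : ℂ) ∂haar K
  rw [← h1, Complex.real_smul]
  congr 2
  ext ξ
  rw [show -(a⁻¹ * (x + b) * (a * ξ)) = -(b * ξ) + -(x * ξ) by field_simp; ring,
    AddChar.map_add_eq_mul]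
  push_cast
  ring

/-- Dual form of `fourier_modulate`. Scaling by `a` moves the dilation from the test function to
`u`, while scaling by `a⁻¹` is needed for local integrability of the dilated `u`. -/
lemma isRepresentedBy_fourier_affine (χ : StandardCharacter K) {a : K} (b : K) (ha : a ≠ 0)
    (h : HaarScales a) (h' : HaarScales a⁻¹) {T : TemperedDistribution K} {u : K → ℂ}
    (hu : (TemperedDistribution.fourier χ T).IsRepresentedBy u) :
    (TemperedDistribution.fourier χ (T.affine a b ha)).IsRepresentedBy fun ξ =>
      ((‖a‖⁻¹ : ℝ) : ℂ) * (χ.toAddChar (-(b * (a⁻¹ * ξ))) : ℂ) * u (a⁻¹ * ξ) := by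
  have ha' : ‖a‖ ≠ 0 := norm_ne_zero_iff.2 ha
  refine ⟨?_, fun f => ?_⟩
  · have h1 := h'.locallyIntegrable_comp (inv_ne_zero ha) hu.1
    have h2 : Continuous fun ξ => ((‖a‖⁻¹ : ℝ) : ℂ) * (χ.toAddChar (-(b * (a⁻¹ * ξ))) : ℂ) :=
      continuous_const.mul (χ.isLocallyConstant.continuous.comp (by fun_prop))
    exact h1.continuous_mul h2
  · have h1 := h.integral_comp ha fun ξ =>
      ((‖a‖⁻¹ : ℝ) : ℂ) * (χ.toAddChar (-(b * (a⁻¹ * ξ))) : ℂ) * u (a⁻¹ * ξ) * (f : K → ℂ) ξ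
    rw [eq_inv_smul_iff₀ ha'] at h1
    have h2 := hu.2 (modulate χ a b ha f)
    change ((‖a‖⁻¹ : ℝ) : ℂ) * T (TestFunction.affine a b ha (χ.fourier f)) = _
    rw [fourier_modulate χ b ha h, map_smul, smul_eq_mul, ← mul_assoc, ← Complex.ofReal_mul,
      inv_mul_cancel₀ ha', Complex.ofReal_one, one_mul, ← h1]
    refine h2.trans ?_
    rw [← integral_smul]
    congr 1
    ext ξ
    change u ξ * ((f : K → ℂ) (a * ξ) * (χ.toAddChar (-(b * ξ)) : ℂ)) = _
    have ha'' : ((‖a‖ : ℝ) : ℂ) ≠ 0 := by exact_mod_cast ha'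
    rw [inv_mul_cancel_left₀ ha, Complex.real_smul]
    push_cast
    field_simp

end FourierAffine

/-! ### Bessel and Parseval for characters on balls -/

section FourierSeries

variable {K : Type*} [NontriviallyNormedField K] [ProperSpace K] [MeasurableSpace K] [BorelSpace K]
  [IsUltrametricDist K]

lemma HilbertBasis.hasSum_norm_inner_sq {ι E : Type*} [NormedAddCommGroup E]
    [InnerProductSpace ℂ E] (b : HilbertBasis ι ℂ E) (x : E) :
    HasSum (fun i => ‖inner ℂ (b i) x‖ ^ 2) (‖x‖ ^ 2) := by
  have h := b.hasSum_inner_mul_inner x x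
  rw [inner_self_eq_norm_sq_to_K] at h
  have h2 : (fun i => inner ℂ x (b i) * inner ℂ (b i) x) =
      fun i => ((‖inner ℂ (b i) x‖ ^ 2 : ℝ) : ℂ) := by
    ext i
    rw [← inner_conj_symm, Complex.conj_mul']
    push_cast
    rfl
  rw [h2] at h
  rw [← Complex.hasSum_ofReal, Complex.ofReal_pow]
  exact h

/-- The Fourier transform has order dividing four on test functions, so every test function is
itself a transform. Moving that transform onto `F` makes all pairings with `F` vanish. -/
lemma ae_eq_zero_of_fourierIntegral_eq_zero (χ : StandardCharacter K) {F : K → ℂ}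
    (hF : Integrable F (haar K)) (h : ∀ x, χ.fourierIntegral F x = 0) : F =ᵐ[haar K] 0 := by
  refine ae_eq_zero_of_forall_testFunction hF.locallyIntegrable fun f => ?_
  have hL : Continuous fun p : K × K => (LinearMap.mul K K) p.1 p.2 := by
    simp only [LinearMap.mul_apply']; fun_prop
  have hLf : (LinearMap.mul K K).flip = LinearMap.mul K K := by
    ext; simp
  set g := χ.fourier (χ.fourier (χ.fourier f)) with hg
  have hflip := VectorFourier.integral_fourierIntegral_smul_eq_flip (μ := haar K) (ν := haar K)
    (L := LinearMap.mul K K) χ.continuous_toAddChar hL hF (integrable_testFunction (haar K) g)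
  rw [hLf, ← StandardCharacter.fourierIntegral_eq, ← StandardCharacter.fourierIntegral_eq] at hflip
  have hfg : χ.fourierIntegral (g : K → ℂ) = (f : K → ℂ) :=
    congrArg Subtype.val (Sobolev.fourier_pow_four f)
  rw [hfg] at hflip
  simpa [h] using hflip.symm

variable (χ : StandardCharacter K) (d : K)

/-- The normalized characters on the ball of radius `|d|`. -/
def ballChar (x ξ : K) : ℂ :=
  (((√((haar K).real (Metric.closedBall 0 ‖d‖)))⁻¹ : ℝ) : ℂ) * (χ.toAddChar (-(x * ξ)) : ℂ)

lemma continuous_ballChar (x : K) : Continuous (ballChar χ d x) :=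
  continuous_const.mul (χ.isLocallyConstant.continuous.comp (by fun_prop))

instance : IsFiniteMeasure ((haar K).restrict (Metric.closedBall 0 ‖d‖)) :=
  ⟨by rw [Measure.restrict_apply_univ]; exact (isCompact_closedBall _ _).measure_lt_top⟩

lemma memLp_ballChar (x : K) :
    MemLp (ballChar χ d x) 2 ((haar K).restrict (Metric.closedBall 0 ‖d‖)) := by
  refine MemLp.of_bound (continuous_ballChar χ d x).aestronglyMeasurable
    (√((haar K).real (Metric.closedBall 0 ‖d‖)))⁻¹ (Eventually.of_forall fun ξ => ?_)
  rw [ballChar, norm_mul, Circle.norm_coe, mul_one, Complex.norm_real,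
    Real.norm_of_nonneg (by positivity)]

lemma inner_ballChar (x : K) (f : Lp ℂ 2 ((haar K).restrict (Metric.closedBall 0 ‖d‖))) :
    inner ℂ ((memLp_ballChar χ d x).toLp _) f =
      (((√((haar K).real (Metric.closedBall 0 ‖d‖)))⁻¹ : ℝ) : ℂ) *
        ∫ ξ in Metric.closedBall 0 ‖d‖, (χ.toAddChar (x * ξ) : ℂ) * f ξ ∂haar K := by
  rw [L2.inner_def, ← integral_const_mul]
  apply integral_congr_ae
  filter_upwards [(memLp_ballChar χ d x).coeFn_toLp] with ξ h
  rw [h, RCLike.inner_apply, ballChar, map_mul, Complex.conj_ofReal, ← Circle.coe_inv_eq_conj,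
    ← AddChar.map_neg_eq_inv, neg_neg]
  ring

/-- A character integrates to zero over a ball on which it is non-trivial, and the separation
hypothesis says exactly that `ν k - ν l` gives such a character. -/
lemma orthonormal_ballChar {d : K} (hd : d ≠ 0) {ν : ℕ → K}
    (hν : ∀ k l, k ≠ l → 1 < ‖(ν k - ν l) * d‖) :
    Orthonormal ℂ fun k => (memLp_ballChar χ d (ν k)).toLp _ := by
  rw [orthonormal_iff_ite]
  intro k l
  have hpos := haar_closedBall_pos hd
  have h1 : ∫ ξ in Metric.closedBall 0 ‖d‖, (χ.toAddChar (ν k * ξ) : ℂ) *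
      ((memLp_ballChar χ d (ν l)).toLp _ : K → ℂ) ξ ∂haar K =
      (((√((haar K).real (Metric.closedBall 0 ‖d‖)))⁻¹ : ℝ) : ℂ) *
        ∫ ξ in Metric.closedBall 0 ‖d‖, (χ.toAddChar (-((ν l - ν k) * ξ)) : ℂ) ∂haar K := by
    rw [← integral_const_mul]
    apply integral_congr_ae
    filter_upwards [(memLp_ballChar χ d (ν l)).coeFn_toLp] with ξ h
    rw [h, ballChar, show -((ν l - ν k) * ξ) = ν k * ξ + -(ν l * ξ) by ring,
      AddChar.map_add_eq_mul]
    push_cast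
    ring
  rw [inner_ballChar, h1, StandardCharacter.integral_char_closedBall, ← mul_assoc,
    ← Complex.ofReal_mul]
  by_cases hkl : k = l
  · subst hkl
    simp only [sub_self, zero_mul, norm_zero, zero_le_one, if_true]
    rw [← Complex.ofReal_mul, ← mul_inv, Real.mul_self_sqrt hpos.le, inv_mul_cancel₀ hpos.ne',
      Complex.ofReal_one]
  · rw [if_neg (not_le.2 (hν l k (Ne.symm hkl))), if_neg hkl, mul_zero]

variable {χ d}

lemma integral_restrict_ball {f : K → ℂ} (hf0 : ∀ ξ, ‖d‖ < ‖ξ‖ → f ξ = 0)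
    (hf : MemLp f 2 (haar K)) (x : K) :
    ‖inner ℂ ((memLp_ballChar χ d x).toLp _)
      ((hf.restrict (Metric.closedBall 0 ‖d‖)).toLp f)‖ ^ 2 =
      ((haar K).real (Metric.closedBall 0 ‖d‖))⁻¹ *
        ‖∫ ξ, (χ.toAddChar (x * ξ) : ℂ) * f ξ ∂haar K‖ ^ 2 := by
  rw [inner_ballChar, norm_mul, mul_pow, Complex.norm_real, Real.norm_of_nonneg (by positivity),
    inv_pow, Real.sq_sqrt measureReal_nonneg]
  congr 3
  have h1 : ∫ ξ in Metric.closedBall 0 ‖d‖, (χ.toAddChar (x * ξ) : ℂ) * f ξ ∂haar K =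
      ∫ ξ, (χ.toAddChar (x * ξ) : ℂ) * f ξ ∂haar K :=
    setIntegral_eq_integral_of_forall_compl_eq_zero fun ξ hξ => by
      rw [hf0 ξ (by simpa using hξ), mul_zero]
  rw [← h1]
  apply integral_congr_ae
  filter_upwards [(hf.restrict (Metric.closedBall 0 ‖d‖)).coeFn_toLp] with ξ h
  rw [h]

lemma norm_sq_toLp_restrict_ball {K : Type*} [NontriviallyNormedField K] [ProperSpace K]
    [MeasurableSpace K] [BorelSpace K] {d : K} {f : K → ℂ} (hf0 : ∀ ξ, ‖d‖ < ‖ξ‖ → f ξ = 0)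
    (hf : MemLp f 2 (haar K)) :
    ‖(hf.restrict (Metric.closedBall 0 ‖d‖)).toLp f‖ ^ 2 = ∫ ξ, ‖f ξ‖ ^ 2 ∂haar K := by
  have h := inner_self_eq_norm_sq_to_K (𝕜 := ℂ)
    ((hf.restrict (Metric.closedBall 0 ‖d‖)).toLp f)
  rw [L2.inner_def] at h
  have h2 : ∫ ξ in Metric.closedBall 0 ‖d‖,
      inner ℂ ((hf.restrict (Metric.closedBall 0 ‖d‖)).toLp f ξ)
        ((hf.restrict (Metric.closedBall 0 ‖d‖)).toLp f ξ) ∂haar K =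
      ((∫ ξ, ‖f ξ‖ ^ 2 ∂haar K : ℝ) : ℂ) := by
    have h1 : ∫ ξ in Metric.closedBall 0 ‖d‖, ‖f ξ‖ ^ 2 ∂haar K = ∫ ξ, ‖f ξ‖ ^ 2 ∂haar K :=
      setIntegral_eq_integral_of_forall_compl_eq_zero fun ξ hξ => by
        rw [hf0 ξ (by simpa using hξ)]; simp
    rw [← h1, ← integral_complex_ofReal]
    apply integral_congr_ae
    filter_upwards [(hf.restrict (Metric.closedBall 0 ‖d‖)).coeFn_toLp] with ξ h
    rw [h, inner_self_eq_norm_sq_to_K]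
    exact (Complex.ofReal_pow _ _).symm
  rw [h2] at h
  exact Complex.ofReal_injective ((h.trans (Complex.ofReal_pow _ _).symm).symm)

/-- Bessel's inequality for characters on a ball. -/
lemma bessel_ball (hd : d ≠ 0) {ν : ℕ → K} (hν : ∀ k l, k ≠ l → 1 < ‖(ν k - ν l) * d‖)
    {f : K → ℂ} (hf0 : ∀ ξ, ‖d‖ < ‖ξ‖ → f ξ = 0) (hf : MemLp f 2 (haar K)) :
    Summable (fun k => ‖∫ ξ, (χ.toAddChar (ν k * ξ) : ℂ) * f ξ ∂haar K‖ ^ 2) ∧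
    ∑' k, ‖∫ ξ, (χ.toAddChar (ν k * ξ) : ℂ) * f ξ ∂haar K‖ ^ 2 ≤
      (haar K).real (Metric.closedBall 0 ‖d‖) * ∫ ξ, ‖f ξ‖ ^ 2 ∂haar K := by
  have hpos := haar_closedBall_pos hd
  have h1 := (orthonormal_ballChar χ hd hν).inner_products_summable
    ((hf.restrict (Metric.closedBall 0 ‖d‖)).toLp f)
  have h2 := (orthonormal_ballChar χ hd hν).tsum_inner_products_le
    ((hf.restrict (Metric.closedBall 0 ‖d‖)).toLp f)
  simp only [integral_restrict_ball hf0 hf] at h1 h2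
  rw [norm_sq_toLp_restrict_ball hf0 hf, tsum_mul_left, inv_mul_le_iff₀ hpos] at h2
  exact ⟨(summable_mul_left_iff (inv_ne_zero hpos.ne')).1 h1, h2⟩

/-- Parseval's identity for a complete system of characters on a ball. -/
lemma parseval_ball (hd : d ≠ 0) {ν : ℕ → K} (hν : ∀ k l, k ≠ l → 1 < ‖(ν k - ν l) * d‖)
    (hν' : ∀ x, ∃ k, ‖(x - ν k) * d‖ ≤ 1)
    {f : K → ℂ} (hf0 : ∀ ξ, ‖d‖ < ‖ξ‖ → f ξ = 0) (hf : MemLp f 2 (haar K)) :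
    HasSum (fun k => ‖∫ ξ, (χ.toAddChar (ν k * ξ) : ℂ) * f ξ ∂haar K‖ ^ 2)
      ((haar K).real (Metric.closedBall 0 ‖d‖) * ∫ ξ, ‖f ξ‖ ^ 2 ∂haar K) := by
  have hpos := haar_closedBall_pos hd
  have hbm : MeasurableSet (Metric.closedBall (0 : K) ‖d‖) :=
    Metric.isClosed_closedBall.measurableSet
  -- Completeness: extend an orthogonal `G` by zero. On the ball every character coincides with one
  -- of the system, so the whole Fourier integral of `G` vanishes, and `G = 0` by uniqueness.
  have hbot : (Submodule.span ℂ (Set.range fun k => (memLp_ballChar χ d (ν k)).toLp _))ᗮ = ⊥ := by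
    rw [Submodule.eq_bot_iff]
    intro G hG
    have hGk : ∀ k, ∫ ξ in Metric.closedBall 0 ‖d‖, (χ.toAddChar (ν k * ξ) : ℂ) * G ξ ∂haar K
        = 0 := by
      intro k
      have h := (Submodule.mem_orthogonal _ _).1 hG _ (Submodule.subset_span ⟨k, rfl⟩)
      rw [inner_ballChar] at h
      refine (mul_eq_zero.1 h).resolve_left ?_
      have : (√((haar K).real (Metric.closedBall 0 ‖d‖)))⁻¹ ≠ 0 := by positivity
      exact_mod_cast this
    have hGi : IntegrableOn G (Metric.closedBall 0 ‖d‖) (haar K) :=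
      (Lp.memLp G).integrable one_le_two
    have hF := ae_eq_zero_of_fourierIntegral_eq_zero χ
      ((integrable_indicator_iff hbm).2 hGi) fun x => by
        -- The sign is due to the kernel `χ(-x ξ)` of the Fourier integral.
        obtain ⟨k, hk⟩ := hν' (-x)
        rw [← hGk k, ← integral_indicator hbm]
        unfold StandardCharacter.fourierIntegral
        congr 1
        ext ξ
        by_cases hξ : ξ ∈ Metric.closedBall (0 : K) ‖d‖
        · rw [Set.indicator_of_mem hξ, Set.indicator_of_mem hξ, mul_comm,
            show -(x * ξ) = ν k * ξ + (-x - ν k) * ξ by ring, AddChar.map_add_eq_mul,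
            χ.eq_one_of_norm_le_one ((-x - ν k) * ξ), mul_one]
          rw [mem_closedBall_zero_iff] at hξ
          refine le_trans ?_ hk
          rw [norm_mul, norm_mul]
          gcongr
        · rw [Set.indicator_of_notMem hξ, Set.indicator_of_notMem hξ, zero_mul]
    apply Lp.ext
    rw [EventuallyEq, ae_restrict_iff' hbm]
    have h0 := (ae_restrict_iff' hbm).1 (Lp.coeFn_zero ℂ 2 ((haar K).restrict
      (Metric.closedBall 0 ‖d‖)))
    filter_upwards [hF, h0] with ξ h1 h2 hξ
    rw [h2 hξ]
    rwa [Set.indicator_of_mem hξ] at h1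
  have h := HilbertBasis.hasSum_norm_inner_sq
    (HilbertBasis.mkOfOrthogonalEqBot (orthonormal_ballChar χ hd hν) hbot)
    ((hf.restrict (Metric.closedBall 0 ‖d‖)).toLp f)
  simp only [HilbertBasis.coe_mkOfOrthogonalEqBot, integral_restrict_ball hf0 hf] at h
  rw [norm_sq_toLp_restrict_ball hf0 hf] at h
  have h2 := h.mul_left ((haar K).real (Metric.closedBall 0 ‖d‖))
  simpa only [mul_inv_cancel_left₀ hpos.ne'] using h2

/-- Parseval's identity on a ball with arbitrary centre. -/
lemma parseval_closedBall (hd : d ≠ 0) {ν : ℕ → K} (hν : ∀ k l, k ≠ l → 1 < ‖(ν k - ν l) * d‖)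
    (hν' : ∀ x, ∃ k, ‖(x - ν k) * d‖ ≤ 1) (z : K)
    {f : K → ℂ} (hf0 : ∀ ξ, ‖d‖ < ‖ξ - z‖ → f ξ = 0) (hf : MemLp f 2 (haar K)) :
    HasSum (fun k => ‖∫ ξ, (χ.toAddChar (ν k * ξ) : ℂ) * f ξ ∂haar K‖ ^ 2)
      ((haar K).real (Metric.closedBall 0 ‖d‖) * ∫ ξ, ‖f ξ‖ ^ 2 ∂haar K) := by
  -- Recentring multiplies the `k`-th coefficient by the phase `χ(ν k * z)`, which the modulus
  -- ignores.
  have h := parseval_ball (χ := χ) hd hν hν' (f := fun ξ => f (ξ + z))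
    (fun ξ hξ => hf0 _ (by simpa using hξ))
    (hf.comp_measurePreserving (measurePreserving_add_right (haar K) z))
  rw [integral_add_right_eq_self (fun ξ => ‖f ξ‖ ^ 2) z] at h
  convert h using 2 with k
  congr 1
  rw [← integral_add_right_eq_self _ z]
  have : ∀ ξ, (χ.toAddChar (ν k * (ξ + z)) : ℂ) * f (ξ + z) =
      (χ.toAddChar (ν k * z) : ℂ) * ((χ.toAddChar (ν k * ξ) : ℂ) * f (ξ + z)) := by
    intro ξ
    rw [mul_add, AddChar.map_add_eq_mul]
    push_cast
    ring
  simp only [this]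
  rw [integral_const_mul, norm_mul, Circle.norm_coe, one_mul]

end FourierSeries

/-! ### Projection onto the closed span of an orthonormal family -/

section Projection

variable {E : Type*} [NormedAddCommGroup E] [InnerProductSpace ℂ E] [CompleteSpace E]

/-- The squared norm of the orthogonal projection onto the closed span of an orthonormal
sequence. -/
lemma hasSum_norm_inner_sq_starProjection {ι : Type*} {Φ : ι → E} (hΦ : Orthonormal ℂ Φ) (h : E) :
    HasSum (fun k => ‖inner ℂ (Φ k) h‖ ^ 2)
      (‖((Submodule.span ℂ (Set.range Φ)).topologicalClosure).starProjection h‖ ^ 2) := by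
  set V := (Submodule.span ℂ (Set.range Φ)).topologicalClosure with hV
  have hmem : ∀ k, Φ k ∈ V := fun k =>
    Submodule.le_topologicalClosure _ (Submodule.subset_span ⟨k, rfl⟩)
  let v : ι → V := fun k => ⟨Φ k, hmem k⟩
  have hv : Orthonormal ℂ v := by
    refine ⟨fun k => hΦ.1 k, fun k l hkl => hΦ.2 hkl⟩
  -- A vector of `V` orthogonal to all `Φ k` is orthogonal to the closure of their span, which is
  -- `V`, hence to itself. So `v` is a Hilbert basis of `V`.
  have hbot : (Submodule.span ℂ (Set.range v))ᗮ = ⊥ := by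
    rw [Submodule.eq_bot_iff]
    intro x hx
    have h1 : (x : E) ∈ (Submodule.span ℂ (Set.range Φ))ᗮ := by
      rw [Submodule.mem_orthogonal]
      intro u hu
      induction hu using Submodule.span_induction with
      | mem y hy =>
        obtain ⟨k, rfl⟩ := hy
        exact (Submodule.mem_orthogonal _ _).1 hx (v k) (Submodule.subset_span ⟨k, rfl⟩)
      | zero => exact inner_zero_left _
      | add y z _ _ hy hz => rw [inner_add_left, hy, hz, add_zero]
      | smul c y _ hy => rw [inner_smul_left, hy, mul_zero]
    rw [← Submodule.orthogonal_closure] at h1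
    exact Subtype.ext (inner_self_eq_zero.1 ((Submodule.mem_orthogonal _ _).1 h1 x x.2))
  have key := HilbertBasis.hasSum_norm_inner_sq (HilbertBasis.mkOfOrthogonalEqBot hv hbot)
    (V.orthogonalProjectionOnto h)
  simp only [HilbertBasis.coe_mkOfOrthogonalEqBot] at key
  have h2 : ∀ k, inner ℂ (v k) (V.orthogonalProjectionOnto h) = inner ℂ (Φ k) h := fun k =>
    Submodule.inner_orthogonalProjectionOnto_eq_of_mem_left (v k) h
  simp only [h2] at key
  exact key

end Projection

/-! ### The Sobolev space seen as weighted L² on the Fourier side -/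

section Weighted

variable {K : Type*} [NontriviallyNormedField K] [ProperSpace K] [MeasurableSpace K] [BorelSpace K]
  [IsUltrametricDist K] {χ : StandardCharacter K} {s : ℝ}

/-- The function `(1 + |ξ|²)^{s/2} T̂(ξ)`. -/
def Sobolev.weighted (T : Sobolev χ s) (ξ : K) : ℂ := weight K s ξ * T.hat ξ

lemma Sobolev.memLp_weighted (T : Sobolev χ s) : MemLp T.weighted 2 (haar K) := T.memLp_hat

lemma norm_weight_sq {K : Type*} [NontriviallyNormedField K] (s : ℝ) (ξ : K) : ‖weight K s ξ‖ ^ 2 = (1 + ‖ξ‖ ^ 2) ^ s := by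
  have h := congrArg norm (weight_mul_conj s ξ)
  rw [norm_mul, Complex.norm_conj, Complex.norm_real, Real.norm_of_nonneg (by positivity)] at h
  rw [pow_two, h]

lemma Sobolev.norm_sq_eq_weighted (T : Sobolev χ s) :
    ‖T‖ ^ 2 = ∫ ξ, ‖T.weighted ξ‖ ^ 2 ∂haar K := by
  rw [Sobolev.norm_sq_eq]
  simp only [Sobolev.weighted, norm_mul, mul_pow, norm_weight_sq]

lemma Sobolev.inner_eq_weighted (S T : Sobolev χ s) :
    inner ℂ S T = ∫ ξ, conj (S.weighted ξ) * T.weighted ξ ∂haar K := by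
  rw [Sobolev.inner_def]
  congr 1
  ext ξ
  rw [← weight_mul_conj, Sobolev.weighted, Sobolev.weighted, map_mul]
  ring

/-- Surjectivity onto L² allows frequency truncations to be made freely without leaving the Sobolev
space. -/
lemma Sobolev.exists_weighted_ae_eq {H : K → ℂ} (hH : MemLp H 2 (haar K)) :
    ∃ T : Sobolev χ s, T.weighted =ᵐ[haar K] H := by
  obtain ⟨T, hT⟩ := Sobolev.toL2_surjective (χ := χ) (s := s) (hH.toLp H)
  refine ⟨T, ?_⟩
  have h1 := Sobolev.coeFn_toL2 T
  rw [hT] at h1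
  exact h1.symm.trans hH.coeFn_toLp

end Weighted

/-! ### One scale: the projection formula, its error, and decay at coarse scales -/

section ShiftSystem

variable {K : Type*} [NontriviallyNormedField K] [ProperSpace K] [MeasurableSpace K] [BorelSpace K]
  [IsUltrametricDist K] {χ : StandardCharacter K} {s : ℝ}

/-- An orthonormal system of distributions `|a|^{1/2} φ(a · - λ_k)`, where the `λ_k` represent
the cosets of the ring of integers. -/
structure IsShiftSystem (a : K) (lam : ℕ → K) (φ : Sobolev χ s) (Φ : ℕ → Sobolev χ s) :
    Prop where
  ne_zero : a ≠ 0
  scales : HaarScales a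
  scales_inv : HaarScales a⁻¹
  separated : ∀ k l, k ≠ l → 1 < ‖lam k - lam l‖
  covering : ∀ x, ∃ k, ‖x - lam k‖ ≤ 1
  eq_affine : ∀ k, Sobolev.toDistribution (Φ k) =
    ((√‖a‖ : ℝ) : ℂ) • (Sobolev.toDistribution φ).affine a (lam k) ne_zero
  orthonormal : Orthonormal ℂ Φ

/-- The common modulus of the functions `(1 + |ξ|²)^{s/2} Φ̂_k(ξ)`. -/
def profile (a : K) (φ : Sobolev χ s) (ξ : K) : ℂ :=
  weight K s ξ * (((√‖a‖)⁻¹ : ℝ) : ℂ) * φ.hat (a⁻¹ * ξ)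

lemma norm_profile_sq (a : K) (φ : Sobolev χ s) (ξ : K) :
    ‖profile a φ ξ‖ ^ 2 = (1 + ‖ξ‖ ^ 2) ^ s * ‖a‖⁻¹ * ‖φ.hat (a⁻¹ * ξ)‖ ^ 2 := by
  rw [profile, norm_mul, norm_mul, mul_pow, mul_pow, norm_weight_sq, Complex.norm_real,
    Real.norm_of_nonneg (by positivity), inv_pow, Real.sq_sqrt (norm_nonneg _)]

/-- The exponent `2 * s` arises because `profile` and `weighted` each carry one copy of the weight;
the factor `‖a‖` undoes the normalization of `profile`. -/
lemma norm_profile_mul_weighted_sq {a : K} (ha : a ≠ 0) (φ h : Sobolev χ s) (ξ : K) :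
    (1 + ‖ξ‖ ^ 2) ^ (2 * s) * ‖h.hat ξ‖ ^ 2 * ‖φ.hat (a⁻¹ * ξ)‖ ^ 2 =
      ‖a‖ * (‖profile a φ ξ‖ ^ 2 * ‖h.weighted ξ‖ ^ 2) := by
  have ha' : ‖a‖ ≠ 0 := norm_ne_zero_iff.2 ha
  rw [norm_profile_sq, Sobolev.weighted, norm_mul, mul_pow, norm_weight_sq, two_mul,
    Real.rpow_add (by positivity)]
  field_simp

namespace IsShiftSystem

variable {a : K} {lam : ℕ → K} {φ : Sobolev χ s} {Φ : ℕ → Sobolev χ s}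

/-- Translation becomes modulation, and the constants combine as `√‖a‖ * ‖a‖⁻¹ = (√‖a‖)⁻¹`. -/
lemma hat_ae_eq (S : IsShiftSystem a lam φ Φ) (k : ℕ) :
    (Φ k).weighted =ᵐ[haar K] fun ξ =>
      (χ.toAddChar (-(lam k * a⁻¹ * ξ)) : ℂ) * profile a φ ξ := by
  have ha : 0 < ‖a‖ := norm_pos_iff.2 S.ne_zero
  have h1 := IsRepresentedBy.smul ((√‖a‖ : ℝ) : ℂ) (isRepresentedBy_fourier_affine χ (lam k)
    S.ne_zero S.scales S.scales_inv φ.isRepresentedBy_hat)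
  have h2 := (Φ k).isRepresentedBy_hat
  rw [S.eq_affine k] at h2
  filter_upwards [isRepresentedBy_unique h2 h1] with ξ hξ
  have h3 : ((√‖a‖ : ℝ) : ℂ) * ((‖a‖⁻¹ : ℝ) : ℂ) = (((√‖a‖)⁻¹ : ℝ) : ℂ) := by
    rw [← Complex.ofReal_mul]
    congr 1
    have h4 : √‖a‖ ≠ 0 := (Real.sqrt_pos.2 ha).ne'
    have h5 := Real.mul_self_sqrt ha.le
    field_simp
    nlinarith
  rw [Sobolev.weighted, hξ, Pi.smul_apply, smul_eq_mul, profile, ← h3, mul_assoc (lam k)]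
  ring

lemma memLp_profile (S : IsShiftSystem a lam φ Φ) : MemLp (profile a φ) 2 (haar K) := by
  refine (Φ 0).memLp_weighted.congr_norm ?_ ?_
  · have h1 := S.scales_inv.locallyIntegrable_comp (inv_ne_zero S.ne_zero) φ.isRepresentedBy_hat.1
    exact ((continuous_weight s).aestronglyMeasurable.mul
      aestronglyMeasurable_const).mul h1.aestronglyMeasurable
  · filter_upwards [S.hat_ae_eq 0] with ξ hξ
    rw [hξ, norm_mul, Circle.norm_coe, one_mul]

lemma inner_eq (S : IsShiftSystem a lam φ Φ) (h : Sobolev χ s) (k : ℕ) :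
    inner ℂ (Φ k) h = ∫ ξ, (χ.toAddChar (lam k * a⁻¹ * ξ) : ℂ) *
      (conj (profile a φ ξ) * h.weighted ξ) ∂haar K := by
  rw [Sobolev.inner_eq_weighted]
  apply integral_congr_ae
  filter_upwards [S.hat_ae_eq k] with ξ hξ
  rw [hξ, map_mul, ← Circle.coe_inv_eq_conj, ← AddChar.map_neg_eq_inv, neg_neg, mul_assoc]

/-- Orthogonality of the frequencies `lam k * a⁻¹` survives on larger balls. The covering property
below is only for radius `‖a‖`, so larger balls give Bessel but not Parseval. -/
lemma norm_mul_lt (S : IsShiftSystem a lam φ Φ) {d : K} (hd : ‖a‖ ≤ ‖d‖) (k l : ℕ) (hkl : k ≠ l) :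
    1 < ‖(lam k * a⁻¹ - lam l * a⁻¹) * d‖ := by
  have ha : 0 < ‖a‖ := norm_pos_iff.2 S.ne_zero
  rw [← sub_mul, norm_mul, norm_mul, mul_assoc, norm_inv]
  refine one_lt_mul_of_lt_of_le (S.separated k l hkl) ?_
  rw [← div_eq_inv_mul]
  exact (one_le_div ha).2 hd

lemma exists_norm_mul_le (S : IsShiftSystem a lam φ Φ) (x : K) :
    ∃ k, ‖(x - lam k * a⁻¹) * a‖ ≤ 1 := by
  obtain ⟨k, hk⟩ := S.covering (x * a)
  refine ⟨k, ?_⟩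
  rwa [sub_mul, inv_mul_cancel_right₀ S.ne_zero]

/-- Orthonormality bounds the modulus of the generator. -/
lemma norm_profile_sq_le (S : IsShiftSystem a lam φ Φ) :
    ∀ᵐ ξ ∂haar K, ‖a‖ * ‖profile a φ ξ‖ ^ 2 ≤ 1 := by
  have hv := S.memLp_profile
  -- A measurable representative is needed so that the superlevel set below is measurable.
  set v := hv.1.mk _ with hvdef
  have hvm : Measurable v := hv.1.stronglyMeasurable_mk.measurable
  have hve : profile a φ =ᵐ[haar K] v := hv.1.ae_eq_mk
  have hv2 : MemLp v 2 (haar K) := hv.ae_eq hve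
  have hvi : Integrable (fun ξ => ‖v ξ‖ ^ 2) (haar K) := hv2.integrable_norm_pow two_ne_zero
  have key : haar K {ξ | 1 < ‖a‖ * ‖v ξ‖ ^ 2} = 0 := by
    apply measure_null_of_locally_null
    intro z _
    refine ⟨Metric.closedBall z ‖a‖ ∩ {ξ | 1 < ‖a‖ * ‖v ξ‖ ^ 2}, ?_, ?_⟩
    · rw [Set.inter_comm]
      exact inter_mem_nhdsWithin _ (Metric.closedBall_mem_nhds z (norm_pos_iff.2 S.ne_zero))
    -- The test element `h` has weighted transform equal to the indicator of `E`. Since `E` lies in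
    -- a ball of radius `‖a‖`, Parseval evaluates its coefficient sum as `‖a‖ ∫_E ‖v‖²`, which
    -- Bessel for `Φ` bounds by the mass of `E`.
    set E := Metric.closedBall z ‖a‖ ∩ {ξ | 1 < ‖a‖ * ‖v ξ‖ ^ 2} with hE
    have hEm : MeasurableSet E := Metric.isClosed_closedBall.measurableSet.inter
      (measurableSet_lt measurable_const ((hvm.norm.pow_const 2).const_mul _))
    have hEfin : haar K E ≠ ∞ :=
      ((measure_mono Set.inter_subset_left).trans_lt
        (isCompact_closedBall z ‖a‖).measure_lt_top).ne
    have hH : MemLp (E.indicator fun _ => (1 : ℂ)) 2 (haar K) :=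
      memLp_indicator_const 2 hEm 1 (Or.inr hEfin)
    obtain ⟨h, hh⟩ := Sobolev.exists_weighted_ae_eq (χ := χ) (s := s) hH
    have hf : MemLp (E.indicator fun ξ => conj (v ξ)) 2 (haar K) :=
      (hv2.star).indicator hEm
    have hpars := parseval_closedBall (χ := χ) S.ne_zero (S.norm_mul_lt le_rfl)
      S.exists_norm_mul_le z (f := E.indicator fun ξ => conj (v ξ)) (fun ξ hξ =>
        Set.indicator_of_notMem (fun hmem => by
          have := hmem.1
          rw [Metric.mem_closedBall, dist_eq_norm] at this
          linarith) _) hf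
    have hinner : ∀ k, inner ℂ (Φ k) h = ∫ ξ, (χ.toAddChar (lam k * a⁻¹ * ξ) : ℂ) *
        E.indicator (fun ξ => conj (v ξ)) ξ ∂haar K := by
      intro k
      rw [S.inner_eq]
      apply integral_congr_ae
      filter_upwards [hh, hve] with ξ h1 h2
      rw [h1, h2]
      by_cases hξ : ξ ∈ E <;> simp [hξ]
    have hbessel := S.orthonormal.tsum_inner_products_le h
    simp only [hinner] at hbessel
    rw [hpars.tsum_eq, S.scales.haar_closedBall S.ne_zero, Sobolev.norm_sq_eq_weighted] at hbessel
    have e1 : ∫ ξ, ‖h.weighted ξ‖ ^ 2 ∂haar K = ∫ ξ in E, (1 : ℝ) ∂haar K := by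
      rw [← integral_indicator hEm]
      apply integral_congr_ae
      filter_upwards [hh] with ξ h1
      rw [h1]
      by_cases hξ : ξ ∈ E <;> simp [hξ]
    have e2 : ∫ ξ, ‖E.indicator (fun ξ => conj (v ξ)) ξ‖ ^ 2 ∂haar K =
        ∫ ξ in E, ‖v ξ‖ ^ 2 ∂haar K := by
      rw [← integral_indicator hEm]
      congr 1
      ext ξ
      by_cases hξ : ξ ∈ E <;> simp [hξ]
    rw [e1, e2, ← integral_const_mul, ← sub_nonpos] at hbessel
    have hone : IntegrableOn (fun _ : K => (1 : ℝ)) E (haar K) := integrableOn_const hEfin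
    rw [← integral_sub (hvi.integrableOn.const_mul _) hone] at hbessel
    by_contra hne
    -- The integrand is strictly positive on `E`, so positive mass would contradict the Bessel
    -- bound.
    have hpos : 0 < ∫ ξ in E, (‖a‖ * ‖v ξ‖ ^ 2 - 1) ∂haar K := by
      rw [setIntegral_pos_iff_support_of_nonneg_ae]
      · refine (pos_iff_ne_zero.2 hne).trans_le (measure_mono fun ξ hξ => ⟨?_, hξ⟩)
        have := hξ.2
        simp only [Set.mem_ofPred_eq] at this
        exact (sub_pos.2 this).ne'
      · refine (ae_restrict_iff' hEm).2 (Eventually.of_forall fun ξ hξ => ?_)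
        have := hξ.2
        simp only [Set.mem_ofPred_eq] at this
        exact (sub_pos.2 this).le
      · exact (hvi.integrableOn.const_mul _).sub hone
    linarith
  have key2 : ∀ᵐ ξ ∂haar K, ¬ 1 < ‖a‖ * ‖v ξ‖ ^ 2 := measure_eq_zero_iff_ae_notMem.1 key
  filter_upwards [key2, hve] with ξ h1 h2
  rw [h2]
  exact not_lt.1 h1

lemma integrable_profile_mul (S : IsShiftSystem a lam φ Φ) (h : Sobolev χ s) :
    Integrable (fun ξ => ‖a‖ * (‖profile a φ ξ‖ ^ 2 * ‖h.weighted ξ‖ ^ 2)) (haar K) := by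
  have hh : Integrable (fun ξ => ‖h.weighted ξ‖ ^ 2) (haar K) :=
    h.memLp_weighted.integrable_norm_pow two_ne_zero
  refine hh.mono' ?_ ?_
  · exact ((S.memLp_profile.1.norm.pow 2).mul hh.1).const_mul _
  · filter_upwards [S.norm_profile_sq_le] with ξ hξ
    rw [Real.norm_of_nonneg (by positivity), ← mul_assoc]
    exact mul_le_of_le_one_left (by positivity) hξ

lemma integral_profile_mul_le (S : IsShiftSystem a lam φ Φ) (h : Sobolev χ s) :
    ∫ ξ, ‖a‖ * (‖profile a φ ξ‖ ^ 2 * ‖h.weighted ξ‖ ^ 2) ∂haar K ≤ ‖h‖ ^ 2 := by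
  rw [Sobolev.norm_sq_eq_weighted]
  refine integral_mono_ae (S.integrable_profile_mul h)
    (h.memLp_weighted.integrable_norm_pow two_ne_zero) ?_
  filter_upwards [S.norm_profile_sq_le] with ξ hξ
  rw [← mul_assoc]
  exact mul_le_of_le_one_left (by positivity) hξ

lemma memLp_profile_mul (S : IsShiftSystem a lam φ Φ) (h : Sobolev χ s) :
    MemLp (fun ξ => conj (profile a φ ξ) * h.weighted ξ) 2 (haar K) := by
  have ha : 0 < ‖a‖ := norm_pos_iff.2 S.ne_zero
  have hm : AEStronglyMeasurable (fun ξ => conj (profile a φ ξ) * h.weighted ξ) (haar K) :=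
    S.memLp_profile.star.1.mul h.memLp_weighted.1
  rw [memLp_two_iff_integrable_sq_norm hm]
  have := (S.integrable_profile_mul h).const_mul ‖a‖⁻¹
  refine this.congr (Eventually.of_forall fun ξ => ?_)
  simp only [norm_mul, Complex.norm_conj, mul_pow]
  field_simp

/-- The formula for the projection is exact on band-limited distributions. -/
lemma norm_starProjection_sq_eq (S : IsShiftSystem a lam φ Φ) {h : Sobolev χ s}
    (hh : ∀ᵐ ξ ∂haar K, ‖a‖ < ‖ξ‖ → h.weighted ξ = 0) :
    ‖(closedSpan Φ).starProjection h‖ ^ 2 =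
      ∫ ξ, ‖a‖ * (‖profile a φ ξ‖ ^ 2 * ‖h.weighted ξ‖ ^ 2) ∂haar K := by
  have hm : MeasurableSet (Metric.closedBall (0 : K) ‖a‖) :=
    Metric.isClosed_closedBall.measurableSet
  set f : K → ℂ := (Metric.closedBall (0 : K) ‖a‖).indicator
    fun ξ => conj (profile a φ ξ) * h.weighted ξ with hf
  have hfe : f =ᵐ[haar K] fun ξ => conj (profile a φ ξ) * h.weighted ξ := by
    filter_upwards [hh] with ξ hξ
    by_cases h1 : ξ ∈ Metric.closedBall (0 : K) ‖a‖
    · rw [hf, Set.indicator_of_mem h1]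
    · rw [hf, Set.indicator_of_notMem h1, hξ (by simpa using h1), mul_zero]
  have hpars := parseval_ball (χ := χ) S.ne_zero (S.norm_mul_lt le_rfl) S.exists_norm_mul_le
    (f := f) (fun ξ hξ => Set.indicator_of_notMem (by simpa using hξ) _)
    ((S.memLp_profile_mul h).indicator hm)
  have hinner : ∀ k, ∫ ξ, (χ.toAddChar (lam k * a⁻¹ * ξ) : ℂ) * f ξ ∂haar K =
      inner ℂ (Φ k) h := by
    intro k
    rw [S.inner_eq]
    apply integral_congr_ae
    filter_upwards [hfe] with ξ hξ
    rw [hξ]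
  simp only [hinner] at hpars
  rw [(hasSum_norm_inner_sq_starProjection S.orthonormal h).unique hpars,
    S.scales.haar_closedBall S.ne_zero, ← integral_const_mul]
  apply integral_congr_ae
  filter_upwards [hfe] with ξ hξ
  rw [hξ, norm_mul, Complex.norm_conj, mul_pow]

/-- Split `h = g + r` at frequency `‖a‖`; the formula is exact for `g`. Passing from `h` to `g`
changes the squared projection norm by at most `2‖h‖‖r‖` and the integral by at most `‖r‖² ≤
‖h‖‖r‖`, whence the constant 3. -/
lemma abs_norm_starProjection_sq_sub_le (S : IsShiftSystem a lam φ Φ) (h : Sobolev χ s) :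
    |‖(closedSpan Φ).starProjection h‖ ^ 2 -
      ∫ ξ, ‖a‖ * (‖profile a φ ξ‖ ^ 2 * ‖h.weighted ξ‖ ^ 2) ∂haar K| ≤
      3 * ‖h‖ * √(∫ ξ in (Metric.closedBall 0 ‖a‖)ᶜ, ‖h.weighted ξ‖ ^ 2 ∂haar K) := by
  have hm : MeasurableSet (Metric.closedBall (0 : K) ‖a‖) :=
    Metric.isClosed_closedBall.measurableSet
  obtain ⟨g, hg⟩ := Sobolev.exists_weighted_ae_eq (χ := χ) (s := s)
    (h.memLp_weighted.indicator hm)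
  obtain ⟨r, hr⟩ := Sobolev.exists_weighted_ae_eq (χ := χ) (s := s)
    (h.memLp_weighted.indicator hm.compl)
  have hsum : h = g + r := by
    apply Sobolev.toL2_injective
    apply Lp.ext
    rw [map_add]
    filter_upwards [Sobolev.coeFn_toL2 h, Lp.coeFn_add (Sobolev.toL2 g) (Sobolev.toL2 r),
      Sobolev.coeFn_toL2 g, Sobolev.coeFn_toL2 r, hg, hr] with ξ h1 h2 h3 h4 h5 h6
    rw [h1, h2, Pi.add_apply, h3, h4]
    change h.weighted ξ = g.weighted ξ + r.weighted ξ
    rw [h5, h6]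
    exact (congrFun (Set.indicator_self_add_compl _ _) ξ).symm
  have hrn : ‖r‖ = √(∫ ξ in (Metric.closedBall 0 ‖a‖)ᶜ, ‖h.weighted ξ‖ ^ 2 ∂haar K) := by
    rw [eq_comm, Real.sqrt_eq_iff_mul_self_eq (by positivity) (norm_nonneg _), ← pow_two,
      Sobolev.norm_sq_eq_weighted, ← integral_indicator hm.compl]
    apply integral_congr_ae
    filter_upwards [hr] with ξ hξ
    rw [hξ]
    by_cases h1 : ξ ∈ (Metric.closedBall (0 : K) ‖a‖)ᶜ
    · rw [Set.indicator_of_mem h1, Set.indicator_of_mem h1]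
    · rw [Set.indicator_of_notMem h1, Set.indicator_of_notMem h1]; simp
  -- Disjoint supports leave no cross terms, so both the norm and the integral are additive.
  have hsplit : ∀ᵐ ξ ∂haar K, ‖h.weighted ξ‖ ^ 2 = ‖g.weighted ξ‖ ^ 2 + ‖r.weighted ξ‖ ^ 2 := by
    filter_upwards [hg, hr] with ξ h1 h2
    rw [h1, h2]
    by_cases hξ : ξ ∈ Metric.closedBall (0 : K) ‖a‖
    · rw [Set.indicator_of_mem hξ, Set.indicator_of_notMem (by simpa using hξ)]; simp
    · rw [Set.indicator_of_notMem hξ, Set.indicator_of_mem (by simpa using hξ)]; simp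
  have hnorm : ‖h‖ ^ 2 = ‖g‖ ^ 2 + ‖r‖ ^ 2 := by
    rw [Sobolev.norm_sq_eq_weighted, Sobolev.norm_sq_eq_weighted, Sobolev.norm_sq_eq_weighted,
      ← integral_add (g.memLp_weighted.integrable_norm_pow two_ne_zero)
        (r.memLp_weighted.integrable_norm_pow two_ne_zero)]
    exact integral_congr_ae hsplit
  have hint : ∫ ξ, ‖a‖ * (‖profile a φ ξ‖ ^ 2 * ‖h.weighted ξ‖ ^ 2) ∂haar K =
      (∫ ξ, ‖a‖ * (‖profile a φ ξ‖ ^ 2 * ‖g.weighted ξ‖ ^ 2) ∂haar K) +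
        ∫ ξ, ‖a‖ * (‖profile a φ ξ‖ ^ 2 * ‖r.weighted ξ‖ ^ 2) ∂haar K := by
    rw [← integral_add (S.integrable_profile_mul g) (S.integrable_profile_mul r)]
    apply integral_congr_ae
    filter_upwards [hsplit] with ξ hξ
    rw [hξ]
    ring
  have hgex := S.norm_starProjection_sq_eq (h := g) (by
    filter_upwards [hg] with ξ hξ h1
    rw [hξ, Set.indicator_of_notMem (by simpa using h1)])
  have hrI := S.integral_profile_mul_le r
  have hrI0 : 0 ≤ ∫ ξ, ‖a‖ * (‖profile a φ ξ‖ ^ 2 * ‖r.weighted ξ‖ ^ 2) ∂haar K :=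
    integral_nonneg fun ξ => by positivity
  rw [hint, ← hgex, ← hrn]
  set P := (closedSpan Φ).starProjection with hP
  have hPh : ‖P h‖ ≤ ‖h‖ := Submodule.norm_starProjection_apply_le _ _
  have hPg : ‖P g‖ ≤ ‖g‖ := Submodule.norm_starProjection_apply_le _ _
  have hPr : ‖P r‖ ≤ ‖r‖ := Submodule.norm_starProjection_apply_le _ _
  have hgh : ‖g‖ ≤ ‖h‖ :=
    (pow_le_pow_iff_left₀ (norm_nonneg _) (norm_nonneg _) two_ne_zero).1
      (by linarith [sq_nonneg ‖r‖])
  have hrh : ‖r‖ ≤ ‖h‖ :=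
    (pow_le_pow_iff_left₀ (norm_nonneg _) (norm_nonneg _) two_ne_zero).1
      (by linarith [sq_nonneg ‖g‖])
  have hdiff : |‖P h‖ - ‖P g‖| ≤ ‖r‖ := by
    refine (abs_norm_sub_norm_le _ _).trans ?_
    rw [← map_sub, hsum, add_sub_cancel_left]
    exact hPr
  have hr0 := norm_nonneg r
  have e1 : |‖P h‖ ^ 2 - ‖P g‖ ^ 2| ≤ ‖r‖ * (2 * ‖h‖) := by
    rw [sq_sub_sq, mul_comm, abs_mul, abs_of_nonneg (a := ‖P h‖ + ‖P g‖) (by positivity)]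
    gcongr
    linarith
  have e2 : ‖r‖ ^ 2 ≤ ‖r‖ * ‖h‖ := by
    rw [pow_two]
    gcongr
  rw [abs_le] at e1 ⊢
  constructor <;> nlinarith [e1.1, e1.2]

/-- Bessel on a ball that may be much larger than `‖a‖`. The price is the volume of that ball, which
stays fixed as the scale coarsens. -/
lemma norm_starProjection_sq_le_of_support (S : IsShiftSystem a lam φ Φ) {d : K}
    (hd : ‖a‖ ≤ ‖d‖) {h : Sobolev χ s} (hsupp : ∀ᵐ ξ ∂haar K, ‖d‖ < ‖ξ‖ → h.weighted ξ = 0) :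
    ‖(closedSpan Φ).starProjection h‖ ^ 2 ≤ (haar K).real (Metric.closedBall 0 ‖d‖) *
      ∫ ξ, ‖conj (profile a φ ξ) * h.weighted ξ‖ ^ 2 ∂haar K := by
  have hd0 : d ≠ 0 := norm_pos_iff.1 ((norm_pos_iff.2 S.ne_zero).trans_le hd)
  have hm : MeasurableSet (Metric.closedBall (0 : K) ‖d‖) :=
    Metric.isClosed_closedBall.measurableSet
  set f : K → ℂ := (Metric.closedBall (0 : K) ‖d‖).indicator
    fun ξ => conj (profile a φ ξ) * h.weighted ξ with hf
  have hfe : f =ᵐ[haar K] fun ξ => conj (profile a φ ξ) * h.weighted ξ := by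
    filter_upwards [hsupp] with ξ hξ
    by_cases h1 : ξ ∈ Metric.closedBall (0 : K) ‖d‖
    · rw [hf, Set.indicator_of_mem h1]
    · rw [hf, Set.indicator_of_notMem h1, hξ (by simpa using h1), mul_zero]
  have hbes := bessel_ball (χ := χ) hd0 (S.norm_mul_lt hd)
    (f := f) (fun ξ hξ => Set.indicator_of_notMem (by simpa using hξ) _)
    ((S.memLp_profile_mul h).indicator hm)
  have hinner : ∀ k, ∫ ξ, (χ.toAddChar (lam k * a⁻¹ * ξ) : ℂ) * f ξ ∂haar K =
      inner ℂ (Φ k) h := by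
    intro k
    rw [S.inner_eq]
    apply integral_congr_ae
    filter_upwards [hfe] with ξ hξ
    rw [hξ]
  have hfn : ∫ ξ, ‖f ξ‖ ^ 2 ∂haar K =
      ∫ ξ, ‖conj (profile a φ ξ) * h.weighted ξ‖ ^ 2 ∂haar K := by
    apply integral_congr_ae
    filter_upwards [hfe] with ξ hξ
    rw [hξ]
  simp only [hinner] at hbes
  rw [← (hasSum_norm_inner_sq_starProjection S.orthonormal h).tsum_eq, ← hfn]
  exact hbes.2

/-- Where `‖ξ‖ ≥ r`, the rescaled frequency is at least `r / ‖a‖`, so `(‖a‖ / r) ^ (2θ) * (1 + ‖a⁻¹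
ξ‖²) ^ θ ≥ 1` may be inserted. The weight inside `profile` is paired with `h`, which is why `M`
bounds `weight * h.weighted`. -/
lemma norm_profile_mul_sq_le (ha : 0 < ‖a‖) {h : Sobolev χ s} {r M θ : ℝ} (hr : 0 < r)
    (hθ : 0 < θ) {ξ : K} (hsupp : ‖ξ‖ < r → h.weighted ξ = 0)
    (hM : ‖weight K s ξ * h.weighted ξ‖ ≤ M) :
    ‖conj (profile a φ ξ) * h.weighted ξ‖ ^ 2 ≤ (M ^ 2 * (‖a‖ / r) ^ (2 * θ) * ‖a‖⁻¹) *
      ((1 + ‖a⁻¹ * ξ‖ ^ 2) ^ θ * ‖φ.hat (a⁻¹ * ξ)‖ ^ 2) := by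
  by_cases hξ : ‖ξ‖ < r
  · rw [hsupp hξ, mul_zero, norm_zero, zero_pow two_ne_zero]
    positivity
  have hx : r / ‖a‖ ≤ ‖a⁻¹ * ξ‖ := by
    rw [norm_mul, norm_inv, div_eq_inv_mul]
    gcongr
    exact not_lt.1 hξ
  generalize hy : ‖a⁻¹ * ξ‖ = y at hx ⊢
  have h4 : 1 ≤ (‖a‖ / r) ^ (2 * θ) * (1 + y ^ 2) ^ θ := by
    rw [Real.rpow_mul (by positivity), ← Real.mul_rpow (by positivity) (by positivity)]
    apply Real.one_le_rpow _ hθ.le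
    rw [Real.rpow_two]
    have h6 : (r / ‖a‖) ^ 2 ≤ y ^ 2 := by gcongr
    calc (1 : ℝ) = (‖a‖ / r) ^ 2 * (r / ‖a‖) ^ 2 := by
          rw [← mul_pow, div_mul_div_cancel₀ hr.ne', div_self ha.ne', one_pow]
      _ ≤ (‖a‖ / r) ^ 2 * (1 + y ^ 2) := by
          gcongr
          linarith
  have h5 : ‖conj (profile a φ ξ) * h.weighted ξ‖ ^ 2 =
      ‖weight K s ξ * h.weighted ξ‖ ^ 2 * (‖a‖⁻¹ * ‖φ.hat (a⁻¹ * ξ)‖ ^ 2) := by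
    rw [norm_mul, Complex.norm_conj, mul_pow, norm_profile_sq, norm_mul, mul_pow,
      norm_weight_sq]
    ring
  rw [h5]
  generalize ‖φ.hat (a⁻¹ * ξ)‖ = z
  calc ‖weight K s ξ * h.weighted ξ‖ ^ 2 * (‖a‖⁻¹ * z ^ 2)
      ≤ M ^ 2 * (‖a‖⁻¹ * z ^ 2) := by gcongr
    _ ≤ M ^ 2 * (‖a‖⁻¹ * z ^ 2) * ((‖a‖ / r) ^ (2 * θ) * (1 + y ^ 2) ^ θ) :=
        le_mul_of_one_le_right (by positivity) h4
    _ = _ := by ring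

/-- Decay of the projection at coarse scales for distributions whose Fourier transform is bounded
and supported in an annulus. -/
lemma norm_starProjection_sq_le (S : IsShiftSystem a lam φ Φ) {d : K} (hd : ‖a‖ ≤ ‖d‖)
    {h : Sobolev χ s} {r M θ A : ℝ} (hr : 0 < r) (hθ : 0 < θ)
    (hsupp : ∀ᵐ ξ ∂haar K, ‖d‖ < ‖ξ‖ ∨ ‖ξ‖ < r → h.weighted ξ = 0)
    (hM : ∀ᵐ ξ ∂haar K, ‖weight K s ξ * h.weighted ξ‖ ≤ M)
    (hint : Integrable (fun ξ => (1 + ‖ξ‖ ^ 2) ^ θ * ‖φ.hat ξ‖ ^ 2) (haar K))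
    (hA : ∫ ξ, (1 + ‖ξ‖ ^ 2) ^ θ * ‖φ.hat ξ‖ ^ 2 ∂haar K ≤ A) :
    ‖(closedSpan Φ).starProjection h‖ ^ 2 ≤
      (haar K).real (Metric.closedBall 0 ‖d‖) * (M ^ 2 * A) * (‖a‖ / r) ^ (2 * θ) := by
  have ha : 0 < ‖a‖ := norm_pos_iff.2 S.ne_zero
  refine (S.norm_starProjection_sq_le_of_support hd
    (hsupp.mono fun ξ hξ h1 => hξ (Or.inl h1))).trans ?_
  rw [mul_assoc]
  refine mul_le_mul_of_nonneg_left ?_ measureReal_nonneg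
  have hGi := S.scales_inv.integrable_comp (inv_ne_zero S.ne_zero) hint
  have hGint := S.scales_inv.integral_comp (inv_ne_zero S.ne_zero)
    fun ξ => (1 + ‖ξ‖ ^ 2) ^ θ * ‖φ.hat ξ‖ ^ 2
  rw [norm_inv, inv_inv, smul_eq_mul] at hGint
  have hbound : ∀ᵐ ξ ∂haar K, ‖conj (profile a φ ξ) * h.weighted ξ‖ ^ 2 ≤
      (M ^ 2 * (‖a‖ / r) ^ (2 * θ) * ‖a‖⁻¹) *
        ((1 + ‖a⁻¹ * ξ‖ ^ 2) ^ θ * ‖φ.hat (a⁻¹ * ξ)‖ ^ 2) := by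
    filter_upwards [hsupp, hM] with ξ h2 h3
    exact norm_profile_mul_sq_le ha hr hθ (fun h1 => h2 (Or.inr h1)) h3
  refine (integral_mono_ae ((S.memLp_profile_mul h).integrable_norm_pow two_ne_zero)
    (hGi.const_mul _) hbound).trans ?_
  -- The Jacobian `‖a‖` of the dilation cancels the `‖a‖⁻¹` coming from `profile`, leaving the
  -- moment of `φ`.
  rw [integral_const_mul, hGint, mul_assoc (M ^ 2 * _), inv_mul_cancel_left₀ ha.ne', mul_assoc,
    mul_assoc, mul_comm A]
  gcongr

end IsShiftSystem

end ShiftSystem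

/-! ### Behaviour of the dilations as the scale tends to infinity -/

section Dilations

variable {K : Type*} [NontriviallyNormedField K] {ϖ : K}

lemma tendsto_norm_zpow_neg_atBot (hϖ : IsPrimeElement ϖ) :
    Tendsto (fun j : ℤ => ‖ϖ ^ (-j)‖) atBot (𝓝 0) := by
  have h1 := tendsto_pow_atTop_nhds_zero_of_lt_one (norm_nonneg ϖ) hϖ.norm_lt_one
  have h2 : Tendsto (fun j : ℤ => (-j).toNat) atBot atTop := by
    refine tendsto_atTop.2 fun n => ?_
    filter_upwards [eventually_le_atBot (-(n : ℤ))] with j hj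
    omega
  refine (h1.comp h2).congr' ?_
  filter_upwards [eventually_le_atBot (0 : ℤ)] with j hj
  rw [Function.comp_apply, ← norm_pow, ← zpow_natCast, Int.toNat_of_nonneg (by omega)]

lemma tendsto_norm_zpow_neg_atTop (hϖ : IsPrimeElement ϖ) :
    Tendsto (fun j : ℤ => ‖ϖ ^ (-j)‖) atTop atTop := by
  have h1 := (tendsto_norm_zpow_neg_atBot hϖ).comp tendsto_neg_atTop_atBot
  have h2 : Tendsto (fun j : ℤ => ‖ϖ ^ (- -j)‖) atTop (𝓝[>] 0) :=
    tendsto_nhdsWithin_iff.2 ⟨h1, Eventually.of_forall fun j =>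
      norm_pos_iff.2 (zpow_ne_zero _ hϖ.ne_zero)⟩
  refine (tendsto_inv_nhdsGT_zero.comp h2).congr fun j => ?_
  rw [Function.comp_apply, ← norm_inv, ← zpow_neg, neg_neg]

variable [ProperSpace K] [MeasurableSpace K] [BorelSpace K]

/-- The tails of an integral over the complements of the dilated unit balls vanish. -/
lemma tendsto_setIntegral_compl_closedBall (hϖ : IsPrimeElement ϖ) {f : K → ℝ}
    (hf : Integrable f (haar K)) :
    Tendsto (fun j : ℤ => ∫ ξ in (Metric.closedBall 0 ‖ϖ ^ (-j)‖)ᶜ, f ξ ∂haar K) atTop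
      (𝓝 0) := by
  have hmono : Monotone fun j : ℤ => ‖ϖ ^ (-j)‖ := by
    intro i j hij
    simp only [norm_zpow]
    exact zpow_le_zpow_right_of_le_one₀ (norm_pos_iff.2 hϖ.ne_zero) hϖ.norm_lt_one.le
      (neg_le_neg hij)
  have h := tendsto_setIntegral_of_antitone (μ := haar K) (f := f)
    (s := fun j : ℤ => (Metric.closedBall (0 : K) ‖ϖ ^ (-j)‖)ᶜ)
    (fun j => Metric.isClosed_closedBall.measurableSet.compl)
    (fun i j hij => Set.compl_subset_compl.2 (Metric.closedBall_subset_closedBall (hmono hij)))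
    ⟨0, hf.integrableOn⟩
  have hempty : ⋂ j : ℤ, (Metric.closedBall (0 : K) ‖ϖ ^ (-j)‖)ᶜ = ∅ := by
    rw [Set.eq_empty_iff_forall_notMem]
    intro x hx
    obtain ⟨j, hj⟩ := ((tendsto_norm_zpow_neg_atTop hϖ).eventually_ge_atTop ‖x‖).exists
    exact Set.mem_iInter.1 hx j (by simpa using hj)
  rwa [hempty, setIntegral_empty] at h

end Dilations

/-! ### Triviality of the intersection -/

section Intersection

variable {K : Type*} [NontriviallyNormedField K] [ProperSpace K] [MeasurableSpace K] [BorelSpace K]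
  [IsUltrametricDist K] {χ : StandardCharacter K} {s : ℝ}

lemma Sobolev.eq_zero_of_weighted_ae_eq_zero {h : Sobolev χ s} (hh : h.weighted =ᵐ[haar K] 0) :
    h = 0 := by
  have h1 : ‖h‖ ^ 2 = 0 := by
    rw [Sobolev.norm_sq_eq_weighted]
    apply integral_eq_zero_of_ae
    filter_upwards [hh] with ξ hξ
    rw [hξ]
    simp
  exact norm_eq_zero.1 (pow_eq_zero_iff two_ne_zero |>.1 h1)

lemma Sobolev.inner_eq_setIntegral {g h : Sobolev χ s} {E : Set K} (hE : MeasurableSet E)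
    (hg : g.weighted =ᵐ[haar K] E.indicator h.weighted) :
    inner ℂ g h = ((∫ ξ in E, ‖h.weighted ξ‖ ^ 2 ∂haar K : ℝ) : ℂ) := by
  rw [Sobolev.inner_eq_weighted, ← integral_indicator hE, ← integral_complex_ofReal]
  apply integral_congr_ae
  filter_upwards [hg] with ξ hξ
  rw [hξ]
  by_cases h1 : ξ ∈ E
  · rw [Set.indicator_of_mem h1, Set.indicator_of_mem h1, Complex.conj_mul']
    push_cast
    rfl
  · rw [Set.indicator_of_notMem h1, Set.indicator_of_notMem h1]
    simp

variable {ϖ : K} {lam : ℕ → K} {φ : ℤ → Sobolev χ s} {Φ : ℤ → ℕ → Sobolev χ s}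

/-- In the one-scale bound `d`, `r`, `M` and `A` do not depend on `j`; only `‖ϖ ^ (-j)‖ ^ (2θ)`
varies, and it tends to zero as `θ > 0`. -/
lemma tendsto_norm_starProjection_atBot (hϖ : IsPrimeElement ϖ)
    (S : ∀ j : ℤ, IsShiftSystem (ϖ ^ (-j)) lam (φ j) (Φ j)) {A θ : ℝ} (hθ : 0 < θ)
    (hA : ∀ j : ℤ, j ≤ 0 → Integrable (fun ξ => (1 + ‖ξ‖ ^ 2) ^ θ * ‖(φ j).hat ξ‖ ^ 2) (haar K) ∧
      ∫ ξ, (1 + ‖ξ‖ ^ 2) ^ θ * ‖(φ j).hat ξ‖ ^ 2 ∂haar K ≤ A)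
    {h : Sobolev χ s} {d : K} {r M : ℝ} (hd : d ≠ 0) (hr : 0 < r)
    (hsupp : ∀ᵐ ξ ∂haar K, ‖d‖ < ‖ξ‖ ∨ ‖ξ‖ < r → h.weighted ξ = 0)
    (hM : ∀ᵐ ξ ∂haar K, ‖weight K s ξ * h.weighted ξ‖ ≤ M) :
    Tendsto (fun j => ‖(closedSpan (Φ j)).starProjection h‖) atBot (𝓝 0) := by
  have h0 := tendsto_norm_zpow_neg_atBot hϖ
  have h1 : Tendsto (fun j : ℤ => (haar K).real (Metric.closedBall 0 ‖d‖) * (M ^ 2 * A) *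
      (‖ϖ ^ (-j)‖ / r) ^ (2 * θ)) atBot (𝓝 0) := by
    have h2 := ((h0.div_const r).rpow_const (p := 2 * θ) (Or.inr (by positivity))).const_mul
      ((haar K).real (Metric.closedBall 0 ‖d‖) * (M ^ 2 * A))
    rwa [zero_div, Real.zero_rpow (by positivity), mul_zero] at h2
  have h3 : Tendsto (fun j => ‖(closedSpan (Φ j)).starProjection h‖ ^ 2) atBot (𝓝 0) := by
    refine squeeze_zero' (Eventually.of_forall fun j => by positivity) ?_ h1
    filter_upwards [eventually_le_atBot (0 : ℤ),
      h0.eventually_le_const (norm_pos_iff.2 hd)] with j hj hjd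
    exact (S j).norm_starProjection_sq_le hjd hr hθ hsupp hM (hA j hj).1 (hA j hj).2
  have h4 := h3.sqrt
  simpa [Real.sqrt_sq] using h4

lemma iInf_closedSpan_eq_bot (hϖ : IsPrimeElement ϖ)
    (S : ∀ j : ℤ, IsShiftSystem (ϖ ^ (-j)) lam (φ j) (Φ j)) {A θ : ℝ} (hθ : 0 < θ)
    (hA : ∀ j : ℤ, j ≤ 0 → Integrable (fun ξ => (1 + ‖ξ‖ ^ 2) ^ θ * ‖(φ j).hat ξ‖ ^ 2) (haar K) ∧
      ∫ ξ, (1 + ‖ξ‖ ^ 2) ^ θ * ‖(φ j).hat ξ‖ ^ 2 ∂haar K ≤ A) :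
    ⨅ j : ℤ, closedSpan (Φ j) = ⊥ := by
  rw [Submodule.eq_bot_iff]
  intro h hh
  rw [Submodule.mem_iInf] at hh
  apply Sobolev.eq_zero_of_weighted_ae_eq_zero
  have hH := h.memLp_weighted
  set H := hH.1.mk _ with hHdef
  have hHm : Measurable H := hH.1.stronglyMeasurable_mk.measurable
  have hHe : h.weighted =ᵐ[haar K] H := hH.1.ae_eq_mk
  have hzero : ∀ n : ℕ, ∀ᵐ ξ ∂haar K,
      ‖ξ‖ ≤ n → ((n : ℝ) + 1)⁻¹ ≤ ‖ξ‖ → ‖weight K s ξ * H ξ‖ ≤ n → h.weighted ξ = 0 := by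
    intro n
    -- Truncating `h` to `E` gives the annular support and the bound required for decay. The shift
    -- in `n + 1` keeps the inner radius positive at `n = 0`.
    set E : Set K := {ξ | ‖ξ‖ ≤ n ∧ ((n : ℝ) + 1)⁻¹ ≤ ‖ξ‖ ∧ ‖weight K s ξ * H ξ‖ ≤ n} with hE
    have hEm : MeasurableSet E := by
      have hw : Measurable fun ξ => ‖weight K s ξ * H ξ‖ :=
        ((continuous_weight s).measurable.mul hHm).norm
      exact (measurableSet_le measurable_norm measurable_const).inter
        ((measurableSet_le measurable_const measurable_norm).inter
        (measurableSet_le hw measurable_const))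
    obtain ⟨g, hg⟩ := Sobolev.exists_weighted_ae_eq (χ := χ) (s := s) (hH.indicator hEm)
    obtain ⟨d, hd⟩ := NormedField.exists_lt_norm K n
    have hd0 : d ≠ 0 := norm_pos_iff.1 ((Nat.cast_nonneg n).trans_lt hd)
    have hlim := tendsto_norm_starProjection_atBot hϖ S hθ hA (h := g) (d := d)
      (r := ((n : ℝ) + 1)⁻¹) (M := n) hd0 (by positivity)
      (by
        filter_upwards [hg] with ξ h1 h2
        rw [h1, Set.indicator_of_notMem]
        rintro ⟨h3, h4, -⟩
        rcases h2 with h2 | h2 <;> linarith)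
      (by
        filter_upwards [hg, hHe] with ξ h1 h2
        rw [h1]
        by_cases h3 : ξ ∈ E
        · rw [Set.indicator_of_mem h3, h2]
          exact h3.2.2
        · rw [Set.indicator_of_notMem h3, mul_zero, norm_zero]
          positivity)
    have hinner : ∀ j, ‖inner ℂ g h‖ ≤ ‖(closedSpan (Φ j)).starProjection g‖ * ‖h‖ := by
      intro j
      -- The projection is self-adjoint and fixes `h`, which lies in every space.
      have h1 : inner ℂ g h = inner ℂ ((closedSpan (Φ j)).starProjection g) h := by
        rw [Submodule.inner_starProjection_left_eq_right,
          Submodule.starProjection_eq_self_iff.2 (hh j)]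
      rw [h1]
      exact norm_inner_le_norm _ _
    have h0 : inner ℂ g h = 0 := by
      have h2 := ge_of_tendsto (hlim.mul_const ‖h‖) (Eventually.of_forall hinner)
      rw [zero_mul] at h2
      exact norm_le_zero_iff.1 h2
    rw [Sobolev.inner_eq_setIntegral hEm hg] at h0
    have h1 : ∫ ξ in E, ‖h.weighted ξ‖ ^ 2 ∂haar K = 0 := by exact_mod_cast h0
    rw [setIntegral_eq_zero_iff_of_nonneg_ae (Eventually.of_forall fun ξ => by positivity)
      (hH.integrable_norm_pow two_ne_zero).integrableOn] at h1
    filter_upwards [(ae_restrict_iff' hEm).1 h1] with ξ hξ h3 h4 h5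
    have := hξ ⟨h3, h4, h5⟩
    simpa using this
  -- The sets `E` exhaust everything except the origin, a null set.
  have hne : ∀ᵐ ξ ∂haar K, ξ ≠ 0 := by
    rw [ae_iff]
    simp
  filter_upwards [ae_all_iff.2 hzero, hne] with ξ h1 h2
  have hpos := norm_pos_iff.2 h2
  obtain ⟨n, hn⟩ := exists_nat_ge (max ‖ξ‖ (max ‖ξ‖⁻¹ ‖weight K s ξ * H ξ‖))
  refine h1 n ((le_max_left _ _).trans hn) ?_
    (((le_max_right _ _).trans (le_max_right _ _)).trans hn)
  have h3 : ‖ξ‖⁻¹ ≤ n := ((le_max_left _ _).trans (le_max_right _ _)).trans hn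
  rw [inv_le_comm₀ (by positivity) hpos]
  linarith

end Intersection

/-! ### The limit at fine scales -/

section Approximation

variable {K : Type*} [NontriviallyNormedField K] [ProperSpace K] [MeasurableSpace K] [BorelSpace K]
  [IsUltrametricDist K] {χ : StandardCharacter K} {s : ℝ}
  {ϖ : K} {lam : ℕ → K} {φ : ℤ → Sobolev χ s} {Φ : ℤ → ℕ → Sobolev χ s}

lemma tendsto_norm_starProjection_sq_sub (hϖ : IsPrimeElement ϖ)
    (S : ∀ j : ℤ, IsShiftSystem (ϖ ^ (-j)) lam (φ j) (Φ j)) (h : Sobolev χ s) :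
    Tendsto (fun j : ℤ => ‖(closedSpan (Φ j)).starProjection h‖ ^ 2 -
      ∫ ξ, ‖ϖ ^ (-j)‖ * (‖profile (ϖ ^ (-j)) (φ j) ξ‖ ^ 2 * ‖h.weighted ξ‖ ^ 2) ∂haar K)
      atTop (𝓝 0) := by
  have h1 := ((tendsto_setIntegral_compl_closedBall hϖ
    (h.memLp_weighted.integrable_norm_pow two_ne_zero)).sqrt).const_mul (3 * ‖h‖)
  rw [Real.sqrt_zero, mul_zero] at h1
  refine squeeze_zero_norm (fun j => ?_) h1
  rw [Real.norm_eq_abs]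
  exact (S j).abs_norm_starProjection_sq_sub_le h

end Approximation

end LocalFieldMRA

end

/-! ### Assembly of the theorem -/

open LocalFieldMRA
theorem mainTheorem7 {K : Type*} [NontriviallyNormedField K] [IsUltrametricDist K] [ProperSpace K]
    [MeasurableSpace K] [BorelSpace K] {p c : ℕ} [Fact p.Prime] [NeZero c]
    [Algebra (ZMod p) 𝓀[K]]
    (ϖ : K) (hϖ : IsPrimeElement ϖ) (hnorm : ‖ϖ‖ = ((p : ℝ) ^ c)⁻¹)
    (e : Fin c → 𝒪[K]) (he_zero : e 0 = 1)
    (b : Module.Basis (Fin c) (ZMod p) 𝓀[K]) (hb : ∀ i, b i = IsLocalRing.residue 𝒪[K] (e i))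
    (χ : StandardCharacter K) (s : ℝ)
    (φ : ℤ → Sobolev χ s) (Φ : ℤ → ℕ → Sobolev χ s)
    (hΦ : ∀ j k, Sobolev.toDistribution (Φ j k) =
      ((((p : ℝ) ^ c) ^ ((j : ℝ) / 2) : ℝ) : ℂ) •
        (Sobolev.toDistribution (φ j)).affine (ϖ ^ (-j)) (translation p ϖ e k)
          (zpow_ne_zero _ hϖ.ne_zero))
    (hortho : ∀ j, Orthonormal ℂ (Φ j)) :
    (∀ h : Sobolev χ s,
      (∀ j : ℤ, Integrable (fun ξ => (1 + ‖ξ‖ ^ 2) ^ (2 * s) * ‖h.hat ξ‖ ^ 2 *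
        ‖(φ j).hat (ϖ ^ j * ξ)‖ ^ 2) (haar K)) ∧
      Tendsto (fun j : ℤ => ‖(closedSpan (Φ j)).starProjection h‖ ^ 2 -
        ∫ ξ, (1 + ‖ξ‖ ^ 2) ^ (2 * s) * ‖h.hat ξ‖ ^ 2 * ‖(φ j).hat (ϖ ^ j * ξ)‖ ^ 2 ∂haar K)
        atTop (𝓝 0)) ∧
    ((∃ A θ : ℝ, 0 < θ ∧ ∀ j : ℤ, j ≤ 0 →
        Integrable (fun ξ => (1 + ‖ξ‖ ^ 2) ^ θ * ‖(φ j).hat ξ‖ ^ 2) (haar K) ∧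
        ∫ ξ, (1 + ‖ξ‖ ^ 2) ^ θ * ‖(φ j).hat ξ‖ ^ 2 ∂haar K ≤ A) →
      ⨅ j : ℤ, closedSpan (Φ j) = ⊥) := by
  have hq : 1 < p ^ c := Nat.one_lt_pow (NeZero.ne c) (Fact.out : p.Prime).one_lt
  have hscale : ∀ j : ℤ, HaarScales (ϖ ^ j) := fun j => by
    have h := haarScales_of_distribHaarChar (Units.mk0 ϖ hϖ.ne_zero ^ j) (by
      rw [distribHaarChar_zpow e b hb hϖ hnorm, Units.val_zpow_eq_zpow_val, Units.val_mk0])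
    rwa [Units.val_zpow_eq_zpow_val, Units.val_mk0] at h
  have hinv : ∀ j : ℤ, (ϖ ^ (-j))⁻¹ = ϖ ^ j := fun j => by rw [zpow_neg, inv_inv]
  -- With `a = ϖ ^ (-j)` one has `‖a‖ = q ^ j`, so the factor `q ^ (j / 2)` is the `√‖a‖` of a shift
  -- system.
  have hsqrt : ∀ j : ℤ, ((p : ℝ) ^ c) ^ ((j : ℝ) / 2) = √‖ϖ ^ (-j)‖ := fun j => by
    rw [norm_zpow, hnorm, zpow_neg, inv_zpow, inv_inv, Real.sqrt_eq_rpow, ← Real.rpow_intCast,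
      ← Real.rpow_mul (by positivity)]
    ring_nf
  have S : ∀ j : ℤ, IsShiftSystem (ϖ ^ (-j)) (translation p ϖ e) (φ j) (Φ j) := fun j =>
    { ne_zero := zpow_ne_zero _ hϖ.ne_zero
      scales := hscale _
      scales_inv := by rw [hinv]; exact hscale j
      separated := fun k l hkl => one_lt_norm_translation_sub e b hb hϖ hq hkl
      covering := exists_norm_sub_translation_le_one e b hb hϖ hq
      eq_affine := fun k => by rw [hΦ, hsqrt]
      orthonormal := hortho j }
  have hform : ∀ (h : Sobolev χ s) (j : ℤ),
      (fun ξ => (1 + ‖ξ‖ ^ 2) ^ (2 * s) * ‖h.hat ξ‖ ^ 2 * ‖(φ j).hat (ϖ ^ j * ξ)‖ ^ 2) =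
        fun ξ => ‖ϖ ^ (-j)‖ * (‖profile (ϖ ^ (-j)) (φ j) ξ‖ ^ 2 * ‖h.weighted ξ‖ ^ 2) := by
    intro h j
    ext ξ
    rw [← norm_profile_mul_weighted_sq (S j).ne_zero, hinv]
  refine ⟨fun h => ⟨fun j => ?_, ?_⟩, ?_⟩
  · rw [hform]
    exact (S j).integrable_profile_mul h
  · simp only [hform]
    exact tendsto_norm_starProjection_sq_sub hϖ S h
  · rintro ⟨A, θ, hθ, hA⟩
    exact iInf_closedSpan_eq_bot hϖ S hθ hA
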